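/- **Theorem 1 (Gaussian limit for One Step Thresholding).** Fix $Q>0$. For integers $n,\mathcal C\ge 1$ and a set $\Lambda\subseteq\{1,\dots,\mathcal C\}$ of transmitted messages with $|\Lambda|=K$, let $s\in\{0,1\}^{\mathcal C}$ be the indicator vector of $\Lambda$, let $X\in\mathbb R^{n\times\mathcal C}$ be a random codebook with i.i.d. $N(0,Q)$ entries, let $z\sim N(0,I_n)$ be independent of $X$, and put $$y=Xs+z,\qquad G=X^{T}y\in\mathbb R^{\mathcal C},$$ so that $G_1,\dots,G_{\mathcal C}$ are the correlations computed by One Step Thresholding. (a) Consider a sequence of such problems with parameters $(K_r,n_r,\mathcal C_r)$ and transmitted sets $\Lambda_r$, with $Q$ fixed, such that, as $r\to\infty$, $$n_r\to\infty,\qquad \frac{K_r}{\mathcal C_r}\to\delta,\qquad \frac{K_r+1/Q}{n_r}\to\rho\in[0,\infty).$$ Let $i_r\in\{1,\dots,\mathcal C_r\}$ for every $r$. Then, in distribution as $r\to\infty$, $$\frac{G_{i_r}}{n_rQ}\longrightarrow\begin{cases}N(1,\rho)&\text{if } i_r\in\Lambda_r\text{ for all } r,\\ N(0,\rho)&\text{if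 } i_r\notin\Lambda_r\text{ for all } r,\end{cases}$$ where the second parameter is the variance and $N(m,0)$ is the point mass at $m$. (b) For a single problem with parameters $(K,n,\mathcal C)$, let $\Phi$ be the standard normal distribution function. If $i\notin\Lambda$, then the distribution function $F$ of $\dfrac{G_i}{nQ\sqrt{(K+1/Q)/n}}$ satisfies $$\sup_{x\in\mathbb R}|F(x)-\Phi(x)|\le\frac{8}{\pi\sqrt n}.$$ If $i\in\Lambda$, $K\ge 2$ and $n\ge 12$, then the distribution function $F$ of $\dfrac{G_i-nQ}{nQ\sqrt{(K+1+1/Q)/n}}$ satisfies $$\sup_{x\in\mathbb R}|F(x)-\Phi(x)|\le\frac{64}{\pi\sqrt n}.$$ -/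

import Mathlib

open MeasureTheory ProbabilityTheory Filter Topology
open scoped NNReal Matrix

/-- The activity pattern `s ∈ {0,1}^C` of a set `Λ` of transmitted messages. -/
def activity {C : ℕ} (Λ : Finset (Fin C)) : Fin C → ℝ :=
  fun j => if j ∈ Λ then 1 else 0

/-- The received vector `y = X s + z`. -/
def received {n C : ℕ} (Λ : Finset (Fin C)) (X : Matrix (Fin n) (Fin C) ℝ) (z : Fin n → ℝ) :
    Fin n → ℝ :=
  X *ᵥ activity Λ + z

/-- The correlations `g = X* y` computed by One Step Thresholding (for a real codebook the adjoint
is the transpose), for the received vector `y = X s + z`. -/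
def ostCorrelation {n C : ℕ} (Λ : Finset (Fin C)) (X : Matrix (Fin n) (Fin C) ℝ)
    (z : Fin n → ℝ) : Fin C → ℝ :=
  Xᵀ *ᵥ received Λ X z

/-- The random codebook `X` has i.i.d. `N(0,Q)` entries, the noise `z` is `N(0, I_n)` (that is, has
i.i.d. standard normal coordinates), and the codebook and the noise are independent. -/
structure IsGaussianModel {Ω : Type*} [MeasurableSpace Ω] (P : Measure Ω) (Q : ℝ≥0) {n C : ℕ}
    (X : Ω → Matrix (Fin n) (Fin C) ℝ) (z : Ω → Fin n → ℝ) : Prop where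
  codebook_law : ∀ i j, HasLaw (fun ω => X ω i j) (gaussianReal 0 Q) P
  noise_law : ∀ i, HasLaw (fun ω => z ω i) (gaussianReal 0 1) P
  indep : iIndepFun
    (Sum.elim (fun (p : Fin n × Fin C) (ω : Ω) => X ω p.1 p.2) (fun (i : Fin n) (ω : Ω) => z ω i)) P

/-! ### The Gaussian distribution function -/

/-! Write `x` for codeword `i` and `w` for the noise plus the other transmitted codewords. Then `G_i
= s_i ‖x‖² + ⟨x, w⟩` (`ostCorrelation_eq`), and `w` is independent of `x` with i.i.d. centred
Gaussian coordinates of variance `kQ + 1`, where `k` counts the other transmitted messages. Given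
`x`, the correlation is therefore exactly Gaussian, and its mean and variance depend on `x` only
through the normalized energy `V = ‖x‖² / (nQ)`. So every affine normalization of `G_i` is a mixture
over `V` of laws `N(μV + o, τV)` (`integral_comp_ostCorrelation`). Since `V` has mean 1 and variance
`2/n`, `E|V - 1| ≤ √2/√n`.

For the limit, the characteristic function of the mixture is `E exp(wV)`, now with `w` a complex
number and `Re w ≤ 0`. It differs from `exp w` by at most `‖w‖ E|V - 1|`, and Lévy's continuity
theorem concludes.

For the explicit bounds, replacing the variance `τV` by `τ` costs at most `(3/2) E|V - 1|`. For an
idle message nothing else is random. For a transmitted one the mean `μV` still fluctuates: `μ(V -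
1)` is a sum of `n` i.i.d. centred multiples of `ξ² - 1`, convolved with `N(0, τ)`. Lindeberg
replacement (`abs_integral_cdf_sub_sum_le`) handles it. The component `N(0, τ)` already smooths the
indicator of a half-line, so no separate smoothing inequality is needed; `K ≥ 2` makes `τ` large
enough for an error of order `1/√n`. -/

lemma cdf_map_eq_integral {Ω : Type*} [MeasurableSpace Ω] {P : Measure Ω} [IsProbabilityMeasure P]
    {Y : Ω → ℝ} (hY : AEMeasurable Y P) (x : ℝ) :
    cdf (P.map Y) x = ∫ ω, (Set.Iic x).indicator (fun _ => (1 : ℝ)) (Y ω) ∂P := by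
  have := Measure.isProbabilityMeasure_map hY
  rw [← integral_map (f := (Set.Iic x).indicator fun _ => (1 : ℝ)) hY
    (by exact (measurable_const.indicator measurableSet_Iic).aestronglyMeasurable),
    integral_indicator_const _ measurableSet_Iic, cdf_eq_real]
  simp

lemma cdf_eq_integral (μ : Measure ℝ) [IsProbabilityMeasure μ] (x : ℝ) :
    cdf μ x = ∫ y, (Set.Iic x).indicator (fun _ => (1 : ℝ)) y ∂μ := by
  simpa using cdf_map_eq_integral (P := μ) (Y := id) aemeasurable_id x

/-- The distribution function of a nondegenerate Gaussian in terms of the standard one. -/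
lemma cdf_gaussianReal (m : ℝ) {v : ℝ≥0} (hv : v ≠ 0) (x : ℝ) :
    cdf (gaussianReal m v) x = cdf (gaussianReal 0 1) ((x - m) / √v) := by
  have hs : 0 < √(v : ℝ) := Real.sqrt_pos.2 (by exact_mod_cast pos_iff_ne_zero.2 hv)
  have h : gaussianReal m v = (gaussianReal 0 1).map (fun y => √(v : ℝ) * y + m) := by
    rw [show (fun y => √(v : ℝ) * y + m) = (· + m) ∘ (√(v : ℝ) * ·) from rfl,
      ← Measure.map_map (by fun_prop) (by fun_prop), gaussianReal_map_const_mul,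
      gaussianReal_map_add_const]
    congr 1
    · simp
    · ext; simp
  have : IsProbabilityMeasure ((gaussianReal 0 1).map (fun y => √(v : ℝ) * y + m)) := by
    rw [← h]; infer_instance
  rw [h, cdf_eq_real, cdf_eq_real, map_measureReal_apply (by fun_prop) measurableSet_Iic]
  congr 1
  ext y
  simp only [Set.mem_preimage, Set.mem_Iic]
  rw [le_div_iff₀ hs, le_sub_iff_add_le, mul_comm]

lemma cdf_gaussianReal_sub (m : ℝ) (v : ℝ≥0) (x w : ℝ) :
    cdf (gaussianReal (m + w) v) x = cdf (gaussianReal m v) (x - w) := by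
  rw [← gaussianReal_map_add_const, cdf_eq_real, cdf_eq_real,
    map_measureReal_apply (by fun_prop) measurableSet_Iic]
  congr 1
  ext y
  simp [le_sub_iff_add_le]

lemma gaussianPDFReal_zero_one (x : ℝ) :
    gaussianPDFReal 0 1 x = (√(2 * Real.pi))⁻¹ * Real.exp (-x ^ 2 / 2) := by
  simp [gaussianPDFReal]

lemma continuous_gaussianPDFReal_zero_one : Continuous (gaussianPDFReal 0 1) := by
  have : gaussianPDFReal 0 1 = fun x => (√(2 * Real.pi))⁻¹ * Real.exp (-x ^ 2 / 2) :=
    funext gaussianPDFReal_zero_one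
  rw [this]; fun_prop

lemma hasDerivAt_gaussianPDFReal_zero_one (x : ℝ) :
    HasDerivAt (gaussianPDFReal 0 1) (-x * gaussianPDFReal 0 1 x) x := by
  have : gaussianPDFReal 0 1 = fun x => (√(2 * Real.pi))⁻¹ * Real.exp (-x ^ 2 / 2) :=
    funext gaussianPDFReal_zero_one
  rw [this]
  have h : HasDerivAt (fun x : ℝ => -x ^ 2 / 2) (-x) x := by
    have := ((hasDerivAt_pow 2 x).neg.div_const 2)
    refine this.congr_deriv ?_
    simp; ring
  refine (h.exp.const_mul _).congr_deriv ?_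
  ring

lemma hasDerivAt_cdf_gaussianReal_zero_one (x : ℝ) :
    HasDerivAt (cdf (gaussianReal 0 1)) (gaussianPDFReal 0 1 x) x := by
  have hInt := integrable_gaussianPDFReal 0 1
  have h : (cdf (gaussianReal 0 1) : ℝ → ℝ) = fun y =>
      cdf (gaussianReal 0 1) 0 + ∫ t in (0 : ℝ)..y, gaussianPDFReal 0 1 t := by
    have hI : ∀ y, cdf (gaussianReal 0 1) y = ∫ t in Set.Iic y, gaussianPDFReal 0 1 t := by
      intro y
      rw [cdf_eq_real, Measure.real, gaussianReal_apply_eq_integral _ one_ne_zero,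
        ENNReal.toReal_ofReal]
      exact integral_nonneg fun t => gaussianPDFReal_nonneg 0 1 t
    ext y
    rw [hI, hI, ← intervalIntegral.integral_Iic_sub_Iic hInt.integrableOn hInt.integrableOn]
    ring
  rw [h]
  refine HasDerivAt.const_add _ ?_
  exact intervalIntegral.integral_hasDerivAt_right hInt.intervalIntegrable
    continuous_gaussianPDFReal_zero_one.stronglyMeasurable.stronglyMeasurableAtFilter
    continuous_gaussianPDFReal_zero_one.continuousAt

/-- The polynomial is the second order truncation of `exp (x²/2)`, and `√(2π) ≥ 2`. It serves the
weights `|x|` and `|x² - 1|` coming from derivatives of the Gaussian distribution function. -/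
lemma gaussianPDFReal_mul_le_half {x c : ℝ} (hc0 : 0 ≤ c)
    (hc : c ≤ 1 + x ^ 2 / 2 + x ^ 4 / 8) : c * gaussianPDFReal 0 1 x ≤ 1 / 2 := by
  rw [gaussianPDFReal_zero_one]
  have h2 : (2 : ℝ) ≤ √(2 * Real.pi) := by
    apply Real.le_sqrt_of_sq_le
    nlinarith [Real.pi_gt_three]
  have h3 : (√(2 * Real.pi))⁻¹ ≤ 1 / 2 := by
    rw [one_div]; exact inv_anti₀ (by norm_num) h2
  have h4 : c ≤ Real.exp (x ^ 2 / 2) := by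
    have := Real.quadratic_le_exp_of_nonneg (x := x ^ 2 / 2) (by positivity)
    nlinarith
  have h5 : c * Real.exp (-x ^ 2 / 2) ≤ 1 := by
    rw [show -x ^ 2 / 2 = -(x ^ 2 / 2) by ring, Real.exp_neg, ← div_eq_mul_inv]
    exact div_le_one_of_le₀ h4 (Real.exp_pos _).le
  have h6 : 0 ≤ c * Real.exp (-x ^ 2 / 2) := by positivity
  calc c * ((√(2 * Real.pi))⁻¹ * Real.exp (-x ^ 2 / 2))
      = (√(2 * Real.pi))⁻¹ * (c * Real.exp (-x ^ 2 / 2)) := by ring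
    _ ≤ 1 / 2 * 1 := by gcongr
    _ = 1 / 2 := by ring

lemma abs_mul_gaussianPDFReal_le_half (x : ℝ) : |x| * gaussianPDFReal 0 1 x ≤ 1 / 2 := by
  refine gaussianPDFReal_mul_le_half (abs_nonneg x) ?_
  have := sq_abs x
  nlinarith [sq_nonneg (|x| - 1), sq_nonneg (x ^ 2)]

lemma abs_sq_sub_one_mul_gaussianPDFReal_le_half (x : ℝ) :
    |x ^ 2 - 1| * gaussianPDFReal 0 1 x ≤ 1 / 2 := by
  refine gaussianPDFReal_mul_le_half (abs_nonneg _) ?_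
  rw [abs_le]
  constructor <;> nlinarith [sq_nonneg (x ^ 2), sq_nonneg (x ^ 2 - 2), sq_nonneg x]

/-- Rescaling the argument of the standard normal distribution function. -/
lemma abs_cdf_gaussianReal_div_sub_le {σ : ℝ} (hσ : 0 < σ) (x : ℝ) :
    |cdf (gaussianReal 0 1) (x / σ) - cdf (gaussianReal 0 1) x| ≤ 3 / 2 * |σ ^ 2 - 1| := by
  have key : |cdf (gaussianReal 0 1) (x / σ) - cdf (gaussianReal 0 1) x|
      ≤ 1 / 2 * |σ - 1| * max 1 (1 / σ) := by
    have hmvt : ∃ ξ ∈ Set.uIcc x (x / σ), cdf (gaussianReal 0 1) (x / σ)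
        - cdf (gaussianReal 0 1) x = gaussianPDFReal 0 1 ξ * (x / σ - x) := by
      have hd := fun y => hasDerivAt_cdf_gaussianReal_zero_one y
      have hc : Continuous (cdf (gaussianReal 0 1)) :=
        continuous_iff_continuousAt.2 fun y => (hd y).continuousAt
      rcases lt_trichotomy x (x / σ) with h | h | h
      · obtain ⟨ξ, hξ, he⟩ := exists_hasDerivAt_eq_slope (cdf (gaussianReal 0 1))
          (gaussianPDFReal 0 1) h hc.continuousOn (fun y _ => hd y)
        refine ⟨ξ, Set.Icc_subset_uIcc (Set.Ioo_subset_Icc_self hξ), ?_⟩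
        rw [he, div_mul_cancel₀]
        exact (sub_pos.2 h).ne'
      · exact ⟨x, Set.left_mem_uIcc, by rw [← h]; ring⟩
      · obtain ⟨ξ, hξ, he⟩ := exists_hasDerivAt_eq_slope (cdf (gaussianReal 0 1))
          (gaussianPDFReal 0 1) h hc.continuousOn (fun y _ => hd y)
        refine ⟨ξ, Set.Icc_subset_uIcc' (Set.Ioo_subset_Icc_self hξ), ?_⟩
        rw [he, ← neg_sub x, mul_neg, div_mul_cancel₀ _ (sub_pos.2 h).ne', neg_sub]
    obtain ⟨ξ, hξ, he⟩ := hmvt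
    have hφ := gaussianPDFReal_nonneg 0 1 ξ
    have hb := abs_mul_gaussianPDFReal_le_half ξ
    -- `x` and `x / σ` have the same sign, so `|ξ|` is at least the smaller of their moduli; the
    -- factor `x` of the increment is thus absorbed by the bounded `|ξ| φ(ξ)`.
    have hx : |x| ≤ |ξ| * max 1 σ := by
      have h0 : |x| ≤ |ξ| ∨ |x / σ| ≤ |ξ| := by
        rcases le_total 0 x with h | h
        · have : 0 ≤ x / σ := by positivity
          rw [abs_of_nonneg h, abs_of_nonneg this]
          rcases Set.mem_uIcc.1 hξ with h' | h'
          · exact Or.inl (h'.1.trans (le_abs_self _))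
          · exact Or.inr (h'.1.trans (le_abs_self _))
        · have : x / σ ≤ 0 := div_nonpos_of_nonpos_of_nonneg h hσ.le
          rw [abs_of_nonpos h, abs_of_nonpos this]
          rcases Set.mem_uIcc.1 hξ with h' | h'
          · exact Or.inr ((neg_le_neg h'.2).trans (neg_le_abs _))
          · exact Or.inl ((neg_le_neg h'.2).trans (neg_le_abs _))
      rcases h0 with h0 | h0
      · exact h0.trans (le_mul_of_one_le_right (abs_nonneg _) (le_max_left _ _))
      · rw [abs_div, abs_of_pos hσ, div_le_iff₀ hσ] at h0
        exact h0.trans (mul_le_mul_of_nonneg_left (le_max_right _ _) (abs_nonneg _))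
    have hmax : max 1 σ * (1 / σ) = max 1 (1 / σ) := by
      rw [max_mul_of_nonneg _ _ (by positivity), mul_one_div_cancel hσ.ne', one_mul, max_comm]
    rw [he, abs_mul, abs_of_nonneg hφ, show x / σ - x = x * (1 / σ) * (1 - σ) by field_simp,
      abs_mul, abs_mul, abs_sub_comm 1 σ, abs_of_pos (show 0 < 1 / σ by positivity)]
    calc gaussianPDFReal 0 1 ξ * (|x| * (1 / σ) * |σ - 1|)
        ≤ gaussianPDFReal 0 1 ξ * (|ξ| * max 1 σ * (1 / σ) * |σ - 1|) := by gcongr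
      _ = (|ξ| * gaussianPDFReal 0 1 ξ) * |σ - 1| * (max 1 σ * (1 / σ)) := by ring
      _ ≤ 1 / 2 * |σ - 1| * (max 1 σ * (1 / σ)) := by gcongr
      _ = _ := by rw [hmax]
  have htriv : |cdf (gaussianReal 0 1) (x / σ) - cdf (gaussianReal 0 1) x| ≤ 1 := by
    have := cdf_nonneg (gaussianReal 0 1) x
    have := cdf_nonneg (gaussianReal 0 1) (x / σ)
    have := cdf_le_one (gaussianReal 0 1) x
    have := cdf_le_one (gaussianReal 0 1) (x / σ)
    rw [abs_le]; constructor <;> linarith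
  -- For `σ ≤ 1/2` the factor `1/σ` in `key` is useless, but there `3/2 * (1 - σ²) ≥ 9/8`, so the
  -- trivial bound 1 suffices.
  rcases le_total 1 σ with h | h
  · refine key.trans ?_
    rw [max_eq_left (by rw [div_le_one hσ]; exact h), abs_of_nonneg (by linarith),
      abs_of_nonneg (by nlinarith)]
    nlinarith
  · rw [abs_of_nonpos (a := σ ^ 2 - 1) (by nlinarith)]
    rcases le_total σ (1 / 2) with h' | h'
    · exact htriv.trans (by nlinarith)
    · refine key.trans ?_
      rw [max_eq_right (by rw [le_div_iff₀ hσ]; linarith), abs_of_nonpos (by linarith),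
        mul_one_div, div_le_iff₀ hσ]
      have : 1 / 2 ≤ 3 / 2 * (σ * (1 + σ)) := by nlinarith
      have h1 : 0 ≤ 1 - σ := by linarith
      nlinarith [mul_le_mul_of_nonneg_left this h1]

/-- Sensitivity of the Gaussian distribution function to a relative change of the variance. -/
lemma abs_cdf_gaussianReal_mul_var_sub_le (m : ℝ) {v : ℝ≥0} (hv : v ≠ 0) (V : ℝ≥0) (x : ℝ) :
    |cdf (gaussianReal m (v * V)) x - cdf (gaussianReal m v) x| ≤ 3 / 2 * |(V : ℝ) - 1| := by
  rcases eq_or_ne V 0 with rfl | hV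
  · have := cdf_nonneg (gaussianReal m (v * 0)) x
    have := cdf_nonneg (gaussianReal m v) x
    have := cdf_le_one (gaussianReal m (v * 0)) x
    have := cdf_le_one (gaussianReal m v) x
    have h : |cdf (gaussianReal m (v * 0)) x - cdf (gaussianReal m v) x| ≤ 1 := by
      rw [abs_le]; constructor <;> linarith
    refine h.trans ?_
    norm_num
  · have hV' : 0 < √(V : ℝ) := Real.sqrt_pos.2 (by exact_mod_cast pos_iff_ne_zero.2 hV)
    rw [cdf_gaussianReal m (mul_ne_zero hv hV), cdf_gaussianReal m hv, NNReal.coe_mul,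
      Real.sqrt_mul v.coe_nonneg, ← div_div]
    simpa using abs_cdf_gaussianReal_div_sub_le hV' ((x - m) / √v)

/-- A third order Taylor estimate from a bound on the third derivative. -/
lemma abs_taylor_two_sub_le {f f₁ f₂ f₃ : ℝ → ℝ} {M : ℝ} (h₀ : ∀ x, HasDerivAt f (f₁ x) x)
    (h₁ : ∀ x, HasDerivAt f₁ (f₂ x) x) (h₂ : ∀ x, HasDerivAt f₂ (f₃ x) x)
    (hM : ∀ x, |f₃ x| ≤ M) (w : ℝ) :
    |f w - f 0 - f₁ 0 * w - f₂ 0 / 2 * w ^ 2| ≤ M * |w| ^ 3 := by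
  have hM0 : 0 ≤ M := (abs_nonneg _).trans (hM 0)
  -- Applied three times, integrating the bound on `f₃` back to `f`; the factor `1/6` is given up.
  have mvt : ∀ (g g' : ℝ → ℝ) (C w : ℝ), (∀ x, HasDerivAt g (g' x) x) →
      (∀ x, |x| ≤ |w| → |g' x| ≤ C) → |g w - g 0| ≤ C * |w| := by
    intro g g' C w hg hC
    have := (convex_closedBall (0 : ℝ) |w|).norm_image_sub_le_of_norm_hasDerivWithin_le
      (f := g) (f' := g') (C := C) (x := 0) (y := w) (fun x _ => (hg x).hasDerivWithinAt)
      (fun x hx => hC x (by simpa using hx)) (by simp) (by simp)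
    simpa using this
  have e2 : ∀ w, |f₂ w - f₂ 0| ≤ M * |w| := fun w => mvt f₂ f₃ M w h₂ fun x _ => hM x
  have e1 : ∀ w, |f₁ w - f₁ 0 - f₂ 0 * w| ≤ M * |w| ^ 2 := by
    intro w
    have := mvt (fun x => f₁ x - f₁ 0 - f₂ 0 * x) (fun x => f₂ x - f₂ 0) (M * |w|) w
      (fun x => (((h₁ x).sub_const (f₁ 0)).sub
        ((hasDerivAt_id x).const_mul (f₂ 0))).congr_deriv (by simp))
      (fun x hx => (e2 x).trans (by gcongr))
    simp only [mul_zero, sub_zero, sub_self] at this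
    exact this.trans_eq (by ring)
  have := mvt (fun x => f x - f 0 - f₁ 0 * x - f₂ 0 / 2 * x ^ 2)
    (fun x => f₁ x - f₁ 0 - f₂ 0 * x) (M * |w| ^ 2) w
    (fun x => by
      refine ((((h₀ x).sub_const (f 0)).sub ((hasDerivAt_id x).const_mul (f₁ 0))).sub
        ((hasDerivAt_pow 2 x).const_mul (f₂ 0 / 2))).congr_deriv ?_
      simp; ring)
    (fun x hx => (e1 x).trans (by gcongr))
  simp only [mul_zero, sub_zero, sub_self, ne_eq, OfNat.ofNat_ne_zero, not_false_eq_true,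
    zero_pow] at this
  exact this.trans_eq (by ring)

/-- Third order Taylor estimate for the Gaussian distribution function. -/
lemma exists_abs_cdf_gaussianReal_taylor_le {v : ℝ≥0} (hv : v ≠ 0) (x : ℝ) :
    ∃ A B C : ℝ, ∀ w : ℝ, |cdf (gaussianReal 0 v) (x - w) - A - B * w - C * w ^ 2|
      ≤ 1 / (2 * √(v : ℝ) ^ 3) * |w| ^ 3 := by
  have hs : 0 < √(v : ℝ) := Real.sqrt_pos.2 (by exact_mod_cast pos_iff_ne_zero.2 hv)
  set s := √(v : ℝ) with hs'
  set φ := gaussianPDFReal 0 1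
  have hl : ∀ w, HasDerivAt (fun w => (x - w) / s) (-1 / s) w := fun w =>
    ((hasDerivAt_id w).const_sub x).div_const s
  have h₀ : ∀ w, HasDerivAt (fun w => cdf (gaussianReal 0 v) (x - w))
      ((-1 / s) * φ ((x - w) / s)) w := by
    intro w
    have : (fun w => cdf (gaussianReal 0 v) (x - w))
        = fun w => cdf (gaussianReal 0 1) ((x - w) / s) := by
      ext w; rw [cdf_gaussianReal 0 hv, sub_zero]
    rw [this]
    exact ((hasDerivAt_cdf_gaussianReal_zero_one _).comp w (hl w)).congr_deriv (by ring)
  have h₁ : ∀ w, HasDerivAt (fun w => (-1 / s) * φ ((x - w) / s))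
      (-(1 / s) ^ 2 * (((x - w) / s) * φ ((x - w) / s))) w := by
    intro w
    refine (((hasDerivAt_gaussianPDFReal_zero_one _).comp w (hl w)).const_mul (-1 / s)).congr_deriv
      ?_
    ring
  have h₂ : ∀ w, HasDerivAt (fun w => -(1 / s) ^ 2 * (((x - w) / s) * φ ((x - w) / s)))
      (-(1 / s) ^ 3 * ((((x - w) / s) ^ 2 - 1) * φ ((x - w) / s))) w := by
    intro w
    refine (((hl w).mul ((hasDerivAt_gaussianPDFReal_zero_one _).comp w (hl w))).const_mul
      (-(1 / s) ^ 2)).congr_deriv ?_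
    simp only [Function.comp]
    ring
  -- The witnesses are the Taylor coefficients at `w = 0`. The third derivative carries `s⁻³` and
  -- the weight `y² - 1`, whence `1 / (2 s³)`.
  refine ⟨_, _, _, fun w => abs_taylor_two_sub_le h₀ h₁ h₂ (fun w => ?_) w⟩
  rw [abs_mul, abs_mul, abs_neg, abs_of_pos (show 0 < (1 / s) ^ 3 by positivity),
    abs_of_nonneg (gaussianPDFReal_nonneg 0 1 _)]
  calc (1 / s) ^ 3 * (|((x - w) / s) ^ 2 - 1| * φ ((x - w) / s)) ≤ (1 / s) ^ 3 * (1 / 2) := by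
        gcongr; exact abs_sq_sub_one_mul_gaussianPDFReal_le_half _
    _ = _ := by field_simp

/-! ### Moments of the standard Gaussian -/

lemma integrable_pow_gaussianReal (v : ℝ≥0) (k : ℕ) :
    Integrable (fun x : ℝ => x ^ k) (gaussianReal 0 v) := by
  have := (memLp_id_gaussianReal (μ := 0) (v := v) (k : ℝ≥0))
  rcases Nat.eq_zero_or_pos k with rfl | hk
  · simp
  · refine (integrable_norm_iff (by fun_prop)).1 ?_
    simpa using this.integrable_norm_pow hk.ne'

lemma integral_gaussianReal_zero_one (f : ℝ → ℝ) :
    ∫ x, f x ∂gaussianReal 0 1 = ∫ x, f x * gaussianPDFReal 0 1 x := by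
  rw [integral_gaussianReal_eq_integral_smul one_ne_zero]
  simp [mul_comm]

lemma integrable_pow_mul_gaussianPDFReal (k : ℕ) :
    Integrable (fun x : ℝ => x ^ k * gaussianPDFReal 0 1 x) := by
  have h := integrable_pow_gaussianReal 1 k
  rw [gaussianReal_of_var_ne_zero _ one_ne_zero,
    integrable_withDensity_iff (measurable_gaussianPDF 0 1)
      (ae_of_all _ fun _ => gaussianPDF_lt_top)] at h
  simpa using h

/-- Gaussian moment recursion. -/
lemma integral_pow_add_two_gaussianReal (k : ℕ) :
    ∫ x, x ^ (k + 2) ∂gaussianReal 0 1 = (k + 1) * ∫ x, x ^ k ∂gaussianReal 0 1 := by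
  -- Integration by parts: this derivative has integral zero over the line.
  have hd : ∀ x : ℝ, HasDerivAt (fun x => x ^ (k + 1) * gaussianPDFReal 0 1 x)
      ((k + 1) * (x ^ k * gaussianPDFReal 0 1 x) - x ^ (k + 2) * gaussianPDFReal 0 1 x) x := by
    intro x
    refine ((hasDerivAt_pow (k + 1) x).mul (hasDerivAt_gaussianPDFReal_zero_one x)).congr_deriv ?_
    push_cast
    ring
  have h1 := (integrable_pow_mul_gaussianPDFReal k).const_mul ((k : ℝ) + 1)
  have h2 := integrable_pow_mul_gaussianPDFReal (k + 2)
  have := integral_eq_zero_of_hasDerivAt_of_integrable hd (h1.sub h2)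
    (integrable_pow_mul_gaussianPDFReal (k + 1))
  rw [integral_sub h1 h2, integral_const_mul] at this
  rw [integral_gaussianReal_zero_one, integral_gaussianReal_zero_one]
  linarith

lemma integral_sq_gaussianReal : ∫ x, x ^ 2 ∂gaussianReal 0 1 = 1 := by
  simpa using integral_pow_add_two_gaussianReal 0

lemma integral_pow_four_gaussianReal : ∫ x, x ^ 4 ∂gaussianReal 0 1 = 3 := by
  rw [integral_pow_add_two_gaussianReal 2, integral_sq_gaussianReal]; norm_num

lemma integral_pow_six_gaussianReal : ∫ x, x ^ 6 ∂gaussianReal 0 1 = 15 := by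
  rw [integral_pow_add_two_gaussianReal 4, integral_pow_four_gaussianReal]; norm_num

lemma integrable_sq_sub_one_gaussianReal :
    Integrable (fun x : ℝ => x ^ 2 - 1) (gaussianReal 0 1) :=
  (integrable_pow_gaussianReal 1 2).sub (integrable_const _)

lemma integral_sq_sub_one_gaussianReal : ∫ x, (x ^ 2 - 1) ∂gaussianReal 0 1 = 0 := by
  rw [integral_sub (integrable_pow_gaussianReal 1 2) (integrable_const _),
    integral_sq_gaussianReal]
  simp

lemma integral_sq_sub_one_sq_gaussianReal :
    ∫ x, (x ^ 2 - 1) ^ 2 ∂gaussianReal 0 1 = 2 := by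
  have h : (fun x : ℝ => (x ^ 2 - 1) ^ 2) = fun x => x ^ 4 - 2 * x ^ 2 + 1 := by ext; ring
  have h4 := integrable_pow_gaussianReal 1 4
  have h2 := (integrable_pow_gaussianReal 1 2).const_mul 2
  have h42 : Integrable (fun x : ℝ => x ^ 4 - 2 * x ^ 2) (gaussianReal 0 1) := h4.sub h2
  rw [h, integral_add h42 (integrable_const _), integral_sub h4 h2, integral_const_mul,
    integral_pow_four_gaussianReal, integral_sq_gaussianReal]
  norm_num

lemma integrable_sq_sub_one_sq_gaussianReal :
    Integrable (fun x : ℝ => (x ^ 2 - 1) ^ 2) (gaussianReal 0 1) := by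
  have h : (fun x : ℝ => (x ^ 2 - 1) ^ 2) = fun x => x ^ 4 - 2 * x ^ 2 + 1 := by ext; ring
  rw [h]
  exact ((integrable_pow_gaussianReal 1 4).sub
    ((integrable_pow_gaussianReal 1 2).const_mul 2)).add (integrable_const _)

lemma abs_sq_sub_one_pow_three_le (x : ℝ) : |x ^ 2 - 1| ^ 3 ≤ x ^ 6 + 1 := by
  rcases le_total (x ^ 2) 1 with h | h
  · rw [abs_of_nonpos (by linarith)]
    have : (-(x ^ 2 - 1)) ^ 3 ≤ 1 := pow_le_one₀ (by linarith) (by nlinarith)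
    have h6 : 0 ≤ x ^ 6 := by positivity
    linarith
  · rw [abs_of_nonneg (by linarith)]
    have : (x ^ 2 - 1) ^ 3 ≤ (x ^ 2) ^ 3 := by gcongr; linarith
    nlinarith

lemma integrable_abs_sq_sub_one_pow_three_gaussianReal :
    Integrable (fun x : ℝ => |x ^ 2 - 1| ^ 3) (gaussianReal 0 1) := by
  refine ((integrable_pow_gaussianReal 1 6).add (integrable_const 1)).mono' (by fun_prop)
    (ae_of_all _ fun x => ?_)
  rw [Real.norm_of_nonneg (by positivity)]
  exact abs_sq_sub_one_pow_three_le x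

/-- The constant is the sixth moment 15 plus 1. -/
lemma integral_abs_sq_sub_one_pow_three_gaussianReal_le :
    ∫ x, |x ^ 2 - 1| ^ 3 ∂gaussianReal 0 1 ≤ 16 := by
  have h6 := integrable_pow_gaussianReal 1 6
  have := integral_mono (integrable_abs_sq_sub_one_pow_three_gaussianReal)
    (h6.add (integrable_const 1)) abs_sq_sub_one_pow_three_le
  refine this.trans_eq ?_
  simp only [Pi.add_apply]
  rw [integral_add h6 (integrable_const _), integral_pow_six_gaussianReal]
  norm_num

lemma integrable_abs_pow_three_gaussianReal (v : ℝ≥0) :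
    Integrable (fun x : ℝ => |x| ^ 3) (gaussianReal 0 v) := by
  simpa using (integrable_pow_gaussianReal v 3).norm

lemma integral_abs_pow_three_gaussianReal_le (v : ℝ≥0) :
    ∫ x, |x| ^ 3 ∂gaussianReal 0 v ≤ 2 * √(v : ℝ) ^ 3 := by
  -- From `|x|³ ≤ (x² + x⁴) / 2`, with moments 1 and 3.
  have h1 : ∫ x, |x| ^ 3 ∂gaussianReal 0 1 ≤ 2 := by
    have h2 := integrable_pow_gaussianReal 1 2
    have h4 := integrable_pow_gaussianReal 1 4
    have := integral_mono (integrable_abs_pow_three_gaussianReal 1)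
      ((h2.add h4).const_mul (1 / 2)) (fun x => by
        simp only [Pi.add_apply]
        have := sq_abs x
        nlinarith [mul_nonneg (sq_nonneg |x|) (sq_nonneg (|x| - 1)), pow_mul |x| 2 2,
          pow_mul x 2 2])
    refine this.trans_eq ?_
    simp only [Pi.add_apply]
    rw [integral_const_mul, integral_add h2 h4, integral_sq_gaussianReal,
      integral_pow_four_gaussianReal]
    norm_num
  have h : gaussianReal 0 v = (gaussianReal 0 1).map (fun y => √(v : ℝ) * y) := by
    rw [gaussianReal_map_const_mul]
    congr 1
    · simp
    · ext; simp
  rw [h, integral_map (by fun_prop) (by fun_prop)]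
  simp only [abs_mul, mul_pow, abs_of_nonneg (Real.sqrt_nonneg _), integral_const_mul]
  nlinarith [pow_nonneg (Real.sqrt_nonneg (v : ℝ)) 3]

/-! ### Replacement by Gaussian summands -/

/-- Two laws with the same first two moments give close expectations to a function that is
approximated to third order by a quadratic polynomial. -/
lemma abs_integral_sub_integral_le_of_taylor {μ ν : Measure ℝ} [IsProbabilityMeasure μ]
    [IsProbabilityMeasure ν] {h : ℝ → ℝ} {A B C M τ b : ℝ}
    (hμ : Integrable h μ) (hν : Integrable h ν)
    (hT : ∀ w, |h w - A - B * w - C * w ^ 2| ≤ M * |w| ^ 3)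
    (hμ1 : Integrable (fun w => w) μ) (hν1 : Integrable (fun w => w) ν)
    (hμ2 : Integrable (fun w => w ^ 2) μ) (hν2 : Integrable (fun w => w ^ 2) ν)
    (hμ3 : Integrable (fun w => |w| ^ 3) μ) (hν3 : Integrable (fun w => |w| ^ 3) ν)
    (eμ1 : ∫ w, w ∂μ = b) (eν1 : ∫ w, w ∂ν = b)
    (eμ2 : ∫ w, w ^ 2 ∂μ = τ) (eν2 : ∫ w, w ^ 2 ∂ν = τ) :
    |∫ w, h w ∂μ - ∫ w, h w ∂ν| ≤ M * (∫ w, |w| ^ 3 ∂μ + ∫ w, |w| ^ 3 ∂ν) := by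
  have key : ∀ (κ : Measure ℝ) [IsProbabilityMeasure κ], Integrable h κ →
      Integrable (fun w => w) κ → Integrable (fun w => w ^ 2) κ →
      Integrable (fun w => |w| ^ 3) κ → ∫ w, w ∂κ = b → ∫ w, w ^ 2 ∂κ = τ →
      |∫ w, h w ∂κ - (A + B * b + C * τ)| ≤ M * ∫ w, |w| ^ 3 ∂κ := by
    intro κ _ i0 i1 i2 i3 e1 e2
    have iA : Integrable (fun _ : ℝ => A) κ := integrable_const A
    have e : ∫ w, h w ∂κ - (A + B * b + C * τ) = ∫ w, (h w - A - B * w - C * w ^ 2) ∂κ := by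
      have j0 : Integrable (fun w => h w - A) κ := i0.sub iA
      have j1 : Integrable (fun w => h w - A - B * w) κ := j0.sub (i1.const_mul B)
      rw [integral_sub j1 (i2.const_mul C), integral_sub j0 (i1.const_mul B),
        integral_sub i0 iA, integral_const_mul,
        integral_const_mul, e1, e2]
      simp; ring
    rw [e, ← integral_const_mul]
    exact norm_integral_le_of_norm_le (i3.const_mul M) (ae_of_all _ fun w => by
      rw [Real.norm_eq_abs]; exact hT w)
  have k1 := abs_le.1 (key μ hμ hμ1 hμ2 hμ3 eμ1 eμ2)
  have k2 := abs_le.1 (key ν hν hν1 hν2 hν3 eν1 eν2)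
  rw [abs_le]
  constructor <;> linarith

lemma integrable_cdf_comp {Ω : Type*} [MeasurableSpace Ω] {P : Measure Ω} [IsFiniteMeasure P]
    (μ : Measure ℝ) {Y : Ω → ℝ} (hY : AEMeasurable Y P) :
    Integrable (fun ω => cdf μ (Y ω)) P := by
  refine Integrable.of_bound
    ((monotone_cdf μ).measurable.comp_aemeasurable hY).aestronglyMeasurable 1
    (ae_of_all _ fun ω => ?_)
  rw [Real.norm_of_nonneg (cdf_nonneg _ _)]
  exact cdf_le_one _ _

/-- The distribution function of a convolution. -/
lemma cdf_conv (μ ν : Measure ℝ) [IsProbabilityMeasure μ] [IsProbabilityMeasure ν] (x : ℝ) :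
    cdf (μ ∗ ν) x = ∫ w, cdf μ (x - w) ∂ν := by
  have hi : Measurable ((Set.Iic x).indicator fun _ => (1 : ℝ)) :=
    measurable_const.indicator measurableSet_Iic
  rw [Measure.conv_comm, Measure.conv, cdf_map_eq_integral (by fun_prop), integral_prod]
  · refine integral_congr_ae (ae_of_all _ fun w => ?_)
    simp only
    rw [cdf_eq_integral]
    refine integral_congr_ae (ae_of_all _ fun y => ?_)
    simp only [Set.indicator, Set.mem_Iic, le_sub_iff_add_le, add_comm w y]
  · refine Integrable.of_bound (hi.comp (by fun_prop)).aestronglyMeasurable 1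
      (ae_of_all _ fun p => ?_)
    simp only [Set.indicator]
    split_ifs <;> simp

/-- **Replacement of summands by Gaussians**: for independent centred summands with law `ν`,
variance `τ` and third absolute moment at most `b`, smoothed by an independent Gaussian of
variance `v`. -/
lemma abs_integral_cdf_sub_sum_le {Ω ι : Type*} [MeasurableSpace Ω] {P : Measure Ω}
    [IsProbabilityMeasure P] {ν : Measure ℝ} [IsProbabilityMeasure ν] {ξ : ι → Ω → ℝ}
    (hind : iIndepFun ξ P) (hlaw : ∀ m, HasLaw (ξ m) ν P) {v τ : ℝ≥0} (hv : v ≠ 0) {b : ℝ}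
    (h1 : Integrable (fun w => w) ν) (h2 : Integrable (fun w => w ^ 2) ν)
    (h3 : Integrable (fun w => |w| ^ 3) ν) (e1 : ∫ w, w ∂ν = 0) (e2 : ∫ w, w ^ 2 ∂ν = τ)
    (e3 : ∫ w, |w| ^ 3 ∂ν ≤ b) (s : Finset ι) (u : ℝ) :
    |∫ ω, cdf (gaussianReal 0 v) (u - ∑ m ∈ s, ξ m ω) ∂P
        - cdf (gaussianReal 0 (v + s.card * τ)) u|
      ≤ s.card * (1 / (2 * √(v : ℝ) ^ 3) * (b + 2 * √(τ : ℝ) ^ 3)) := by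
  classical
  -- `u` must vary because the summand split off shifts the argument.
  induction s using Finset.induction_on generalizing u with
  | empty => simp
  | insert m s hm ih =>
    set D := 1 / (2 * √(v : ℝ) ^ 3) * (b + 2 * √(τ : ℝ) ^ 3) with hD
    set v' : ℝ≥0 := v + s.card * τ with hv'
    have hvv' : v ≤ v' := le_self_add
    have hv'0 : v' ≠ 0 := (lt_of_lt_of_le (pos_iff_ne_zero.2 hv) hvv').ne'
    have hsv : 0 < √(v : ℝ) := Real.sqrt_pos.2 (by exact_mod_cast pos_iff_ne_zero.2 hv)
    have hmeas : ∀ m, AEMeasurable (ξ m) P := fun m => (hlaw m).aemeasurable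
    have hS : AEMeasurable (fun ω => ∑ j ∈ s, ξ j ω) P :=
      Finset.aemeasurable_fun_sum _ fun j _ => hmeas j
    have hI : IndepFun (ξ m) (fun ω => ∑ j ∈ s, ξ j ω) P := by
      have := (hind.indepFun_finsetSum_of_notMem₀ hmeas hm).symm
      simpa [Finset.sum_fn] using this
    have split : ∫ ω, cdf (gaussianReal 0 v) (u - ∑ j ∈ insert m s, ξ j ω) ∂P
        = ∫ w, (∫ ω, cdf (gaussianReal 0 v) ((u - w) - ∑ j ∈ s, ξ j ω) ∂P) ∂ν := by
      have hprod := (indepFun_iff_map_prod_eq_prod_map_map (hmeas m) hS).1 hI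
      rw [(hlaw m).map_eq] at hprod
      have := Measure.isProbabilityMeasure_map hS
      have hInt : Integrable (fun p : ℝ × ℝ => cdf (gaussianReal 0 v) (u - (p.1 + p.2)))
          (ν.prod (P.map fun ω => ∑ j ∈ s, ξ j ω)) := integrable_cdf_comp _ (by fun_prop)
      calc ∫ ω, cdf (gaussianReal 0 v) (u - ∑ j ∈ insert m s, ξ j ω) ∂P
          = ∫ ω, (fun p : ℝ × ℝ => cdf (gaussianReal 0 v) (u - (p.1 + p.2)))
              (ξ m ω, ∑ j ∈ s, ξ j ω) ∂P := by simp only [Finset.sum_insert hm]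
        _ = ∫ p, cdf (gaussianReal 0 v) (u - (p.1 + p.2))
              ∂(ν.prod (P.map fun ω => ∑ j ∈ s, ξ j ω)) := by
            rw [← hprod, integral_map ((hmeas m).prodMk hS)]
            rw [hprod]; exact hInt.aestronglyMeasurable
        _ = _ := by
            rw [integral_prod _ hInt]
            refine integral_congr_ae (ae_of_all _ fun w => ?_)
            simp only
            rw [integral_map hS]
            · simp only [sub_sub]
            · exact (integrable_cdf_comp _ (by fun_prop)).aestronglyMeasurable
    have iν : Integrable (fun w => cdf (gaussianReal 0 v') (u - w)) ν :=
      integrable_cdf_comp _ (by fun_prop)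
    have iγ : Integrable (fun w => cdf (gaussianReal 0 v') (u - w)) (gaussianReal 0 τ) :=
      integrable_cdf_comp _ (by fun_prop)
    have iouter : Integrable (fun w => ∫ ω, cdf (gaussianReal 0 v) ((u - w) - ∑ j ∈ s, ξ j ω) ∂P)
        ν := by
      have := Measure.isProbabilityMeasure_map hS
      have hInt : Integrable (fun p : ℝ × ℝ => cdf (gaussianReal 0 v) ((u - p.1) - p.2))
          (ν.prod (P.map fun ω => ∑ j ∈ s, ξ j ω)) := integrable_cdf_comp _ (by fun_prop)
      refine hInt.integral_prod_left.congr (ae_of_all _ fun w => ?_)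
      simp only
      rw [integral_map hS]
      exact (integrable_cdf_comp _ (by fun_prop)).aestronglyMeasurable
    have first : |∫ w, (∫ ω, cdf (gaussianReal 0 v) ((u - w) - ∑ j ∈ s, ξ j ω) ∂P) ∂ν
        - ∫ w, cdf (gaussianReal 0 v') (u - w) ∂ν| ≤ s.card * D := by
      rw [← integral_sub iouter iν]
      have := norm_integral_le_of_norm_le_const (μ := ν) (C := s.card * D)
        (ae_of_all _ fun w => by rw [Real.norm_eq_abs]; exact ih (u - w))
      simpa using this
    obtain ⟨A, B, C, hT⟩ := exists_abs_cdf_gaussianReal_taylor_le hv'0 u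
    -- Only the new summand is exchanged here. The earlier Gaussian replacements can only increase
    -- the smoothing variance, `v ≤ v'`, so each exchange costs at most the same `D`.
    have second : |∫ w, cdf (gaussianReal 0 v') (u - w) ∂ν
        - ∫ w, cdf (gaussianReal 0 v') (u - w) ∂(gaussianReal 0 τ)| ≤ D := by
      refine (abs_integral_sub_integral_le_of_taylor (b := 0) (τ := τ) iν iγ hT h1
        (by simpa using integrable_pow_gaussianReal τ 1) h2 (integrable_pow_gaussianReal τ 2) h3
        (integrable_abs_pow_three_gaussianReal τ) e1 integral_id_gaussianReal e2 ?_).trans ?_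
      · have := variance_id_gaussianReal (μ := 0) (v := τ)
        rw [variance_eq_integral (by fun_prop)] at this
        simpa using this
      · have h0 : 0 ≤ b := (integral_nonneg fun w => by positivity).trans e3
        have := integral_abs_pow_three_gaussianReal_le τ
        have hle : √(v : ℝ) ≤ √(v' : ℝ) := Real.sqrt_le_sqrt (by exact_mod_cast hvv')
        rw [hD]
        gcongr
    have third : ∫ w, cdf (gaussianReal 0 v') (u - w) ∂(gaussianReal 0 τ)
        = cdf (gaussianReal 0 (v + (insert m s).card * τ)) u := by
      rw [← cdf_conv, gaussianReal_conv_gaussianReal, Finset.card_insert_of_notMem hm, hv']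
      congr 3
      · simp
      · push_cast; ring
    rw [split, ← third, Finset.card_insert_of_notMem hm]
    push_cast
    have f := abs_le.1 first
    have g := abs_le.1 second
    rw [abs_le]
    constructor <;> linarith

/-! ### Conditioning a correlation on its codeword -/

/-- A linear combination of independent centred Gaussians. -/
lemma hasLaw_sum_mul_gaussianReal {Ω ι : Type*} [MeasurableSpace Ω] {P : Measure Ω}
    [IsProbabilityMeasure P] {Y : ι → Ω → ℝ} {q : ι → ℝ≥0} (hind : iIndepFun Y P)
    (hlaw : ∀ p, HasLaw (Y p) (gaussianReal 0 (q p)) P) (c : ι → ℝ) (s : Finset ι) :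
    HasLaw (fun ω => ∑ p ∈ s, c p * Y p ω) (gaussianReal 0 (∑ p ∈ s, ‖c p‖₊ ^ 2 * q p)) P := by
  classical
  have hmeas : ∀ p, AEMeasurable (fun ω => c p * Y p ω) P :=
    fun p => (hlaw p).aemeasurable.const_mul _
  refine ⟨Finset.aemeasurable_fun_sum _ fun p _ => hmeas p, ?_⟩
  induction s using Finset.induction_on with
  | empty => simp
  | insert p s hp ih =>
    have hI := (hind.comp (fun p y => c p * y) (fun p => by fun_prop)).indepFun_finsetSum_of_notMem₀
      hmeas hp
    have h1 : P.map (fun ω => c p * Y p ω) = gaussianReal 0 (‖c p‖₊ ^ 2 * q p) := by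
      rw [(gaussianReal_const_mul (hlaw p) (c p)).map_eq]
      congr 1
      · simp
      · ext; simp
    have := gaussianReal_add_gaussianReal_of_indepFun hI.symm h1
      (by rw [← ih]; congr 1; ext ω; simp)
    rw [add_zero] at this
    rw [Finset.sum_insert hp, ← this]
    congr 1
    ext ω
    simp [Finset.sum_insert hp]

/-- The part of the received vector that does not come from message `i`. -/
def interference {n C : ℕ} (Λ : Finset (Fin C)) (i : Fin C) (X : Matrix (Fin n) (Fin C) ℝ)
    (z : Fin n → ℝ) : Fin n → ℝ :=
  fun m => ∑ j ∈ Λ.erase i, X m j + z m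

/-- The squared norm of codeword `i` divided by its expectation. -/
noncomputable def normalizedEnergy (Q : ℝ≥0) {n C : ℕ} (i : Fin C)
    (X : Matrix (Fin n) (Fin C) ℝ) : ℝ≥0 :=
  (∑ m, ‖X m i‖₊ ^ 2) / (n * Q)

lemma coe_normalizedEnergy (Q : ℝ≥0) {n C : ℕ} (i : Fin C) (X : Matrix (Fin n) (Fin C) ℝ) :
    (normalizedEnergy Q i X : ℝ) = (∑ m, X m i ^ 2) / (n * Q) := by
  simp [normalizedEnergy]

/-- Using `Λ.erase i` keeps column `i` out of the interference and treats transmitted and idle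
messages at once. -/
lemma ostCorrelation_eq {n C : ℕ} (Λ : Finset (Fin C)) (i : Fin C) (X : Matrix (Fin n) (Fin C) ℝ)
    (z : Fin n → ℝ) :
    ostCorrelation Λ X z i = activity Λ i * ∑ m, X m i ^ 2
      + ∑ m, X m i * interference Λ i X z m := by
  have h : ∀ m, received Λ X z m = activity Λ i * X m i + interference Λ i X z m := by
    intro m
    have : (X *ᵥ activity Λ) m = ∑ j ∈ Λ, X m j := by
      simp [Matrix.mulVec, dotProduct, activity]
    simp only [received, Pi.add_apply, this, interference, activity]
    by_cases hi : i ∈ Λ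
    · rw [← Finset.add_sum_erase _ _ hi]; simp [hi]; ring
    · simp [hi]
  simp only [ostCorrelation, Matrix.mulVec, dotProduct, Matrix.transpose_apply, h]
  rw [Finset.mul_sum, ← Finset.sum_add_distrib]
  refine Finset.sum_congr rfl fun m _ => ?_
  ring

namespace IsGaussianModel

variable {Ω : Type*} [MeasurableSpace Ω] {P : Measure Ω} {Q : ℝ≥0}
  {n C : ℕ} {X : Ω → Matrix (Fin n) (Fin C) ℝ} {z : Ω → Fin n → ℝ}

lemma aemeasurable_codebook (hM : IsGaussianModel P Q X z) (m : Fin n) (j : Fin C) :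
    AEMeasurable (fun ω => X ω m j) P := (hM.codebook_law m j).aemeasurable

lemma aemeasurable_interference (hM : IsGaussianModel P Q X z) (Λ : Finset (Fin C)) (i : Fin C) :
    AEMeasurable (fun ω => interference Λ i (X ω) (z ω)) P := by
  refine aemeasurable_pi_lambda _ fun m => ?_
  exact (Finset.aemeasurable_fun_sum _ fun j _ => hM.aemeasurable_codebook m j).add
    (hM.noise_law m).aemeasurable

lemma aemeasurable_codeword (hM : IsGaussianModel P Q X z) (i : Fin C) :
    AEMeasurable (fun ω m => X ω m i) P :=
  aemeasurable_pi_lambda _ fun m => hM.aemeasurable_codebook m i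

lemma aemeasurable_ostCorrelation (hM : IsGaussianModel P Q X z) (Λ : Finset (Fin C))
    (i : Fin C) : AEMeasurable (fun ω => ostCorrelation Λ (X ω) (z ω) i) P := by
  simp only [ostCorrelation_eq]
  refine AEMeasurable.add (AEMeasurable.const_mul (Finset.aemeasurable_fun_sum _ fun m _ =>
    (hM.aemeasurable_codebook m i).pow_const 2) _) (Finset.aemeasurable_fun_sum _ fun m _ => ?_)
  exact (hM.aemeasurable_codebook m i).mul
    ((measurable_pi_apply m).comp_aemeasurable (hM.aemeasurable_interference Λ i))

lemma aemeasurable_normalizedEnergy (hM : IsGaussianModel P Q X z) (i : Fin C) :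
    AEMeasurable (fun ω => normalizedEnergy Q i (X ω)) P :=
  (Finset.aemeasurable_fun_sum _ fun m _ =>
    (hM.aemeasurable_codebook m i).nnnorm.pow_const 2).div_const _

lemma aemeasurable_entry (hM : IsGaussianModel P Q X z) (p : (Fin n × Fin C) ⊕ Fin n) :
    AEMeasurable (Sum.elim (fun (p : Fin n × Fin C) (ω : Ω) => X ω p.1 p.2)
      (fun (i : Fin n) (ω : Ω) => z ω i) p) P := by
  rcases p with p | m
  · exact hM.aemeasurable_codebook p.1 p.2
  · exact (hM.noise_law m).aemeasurable

/-- A codeword is independent of the interference it suffers. -/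
lemma indepFun_codeword_interference (hM : IsGaussianModel P Q X z) (Λ : Finset (Fin C))
    (i : Fin C) :
    IndepFun (fun ω m => X ω m i) (fun ω => interference Λ i (X ω) (z ω)) P := by
  classical
  -- `S` indexes column `i`; the interference is a function of the entries in the complement.
  let S : Finset ((Fin n × Fin C) ⊕ Fin n) := Finset.univ.image fun m => Sum.inl (m, i)
  have hS : ∀ m, (Sum.inl (m, i) : (Fin n × Fin C) ⊕ Fin n) ∈ S := fun m => by simp [S]
  have hT : ∀ m, ∀ j, j ≠ i → (Sum.inl (m, j) : (Fin n × Fin C) ⊕ Fin n) ∈ Sᶜ := by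
    intro m j hj; simp [S, hj.symm]
  have hT' : ∀ m, (Sum.inr m : (Fin n × Fin C) ⊕ Fin n) ∈ Sᶜ := fun m => by simp [S]
  have h := hM.indep.indepFun_finset₀ S Sᶜ disjoint_compl_right hM.aemeasurable_entry
  have h' := h.comp (φ := fun (a : S → ℝ) m => a ⟨_, hS m⟩)
    (ψ := fun (b : (Sᶜ : Finset _) → ℝ) m =>
      ∑ j ∈ (Λ.erase i).attach, b ⟨_, hT m j (Finset.ne_of_mem_erase j.2)⟩ + b ⟨_, hT' m⟩)
    (by fun_prop) (by fun_prop)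
  convert! h' using 2 with ω
  ext m
  simp only [interference, Function.comp, Sum.elim_inl, Sum.elim_inr]
  rw [← Finset.sum_attach]

/-- A fixed linear combination of the interference is Gaussian. -/
lemma hasLaw_sum_mul_interference [IsProbabilityMeasure P] (hM : IsGaussianModel P Q X z)
    (Λ : Finset (Fin C)) (i : Fin C) (c : Fin n → ℝ) :
    HasLaw (fun ω => ∑ m, c m * interference Λ i (X ω) (z ω) m)
      (gaussianReal 0 (((Λ.erase i).card * Q + 1) * ∑ m, ‖c m‖₊ ^ 2)) P := by
  classical
  have h := hasLaw_sum_mul_gaussianReal hM.indep (q := Sum.elim (fun _ => Q) (fun _ => 1))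
    (by
      rintro (p | m)
      · exact hM.codebook_law p.1 p.2
      · exact hM.noise_law m)
    (Sum.elim (fun p => if p.2 ∈ Λ.erase i then c p.1 else 0) c) Finset.univ
  convert! h using 1
  · ext ω
    rw [Fintype.sum_sum_type, Fintype.sum_prod_type]
    simp only [Sum.elim_inl, Sum.elim_inr, ite_mul, zero_mul, Finset.sum_ite_mem,
      Finset.univ_inter, interference, mul_add, Finset.sum_add_distrib, Finset.mul_sum]
  · congr 1
    rw [Fintype.sum_sum_type, Fintype.sum_prod_type]
    have : ∀ (m : Fin n) (j : Fin C), ‖(if j ∈ Λ.erase i then c m else 0 : ℝ)‖₊ ^ 2 * Q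
        = if j ∈ Λ.erase i then ‖c m‖₊ ^ 2 * Q else 0 := by
      intro m j; split_ifs <;> simp
    simp only [Sum.elim_inl, Sum.elim_inr, this, Finset.sum_ite_mem, Finset.univ_inter,
      Finset.sum_const, mul_one, nsmul_eq_mul]
    rw [add_mul, one_mul, Finset.mul_sum]
    congr 1
    refine Finset.sum_congr rfl fun m _ => ?_
    ring

/-- Conditionally on codeword `i`, an affine function of the correlation `G_i` is Gaussian, with
mean and variance given by the normalized energy of the codeword. -/
lemma integral_comp_ostCorrelation [IsProbabilityMeasure P] (hM : IsGaussianModel P Q X z)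
    (hQ : 0 < Q) (hn : 0 < n) (Λ : Finset (Fin C)) (i : Fin C) {E : Type*} [NormedAddCommGroup E]
    [NormedSpace ℝ E]
    {g : ℝ → E} (hg : StronglyMeasurable g) {B : ℝ} (hB : ∀ y, ‖g y‖ ≤ B) {p o μ : ℝ} {τ : ℝ≥0}
    (hμ : p * (activity Λ i * (n * Q)) = μ)
    (hτ : p ^ 2 * (((Λ.erase i).card * Q + 1) * (n * Q)) = (τ : ℝ)) :
    ∫ ω, g (p * ostCorrelation Λ (X ω) (z ω) i + o) ∂P
      = ∫ ω, ∫ y, g y ∂gaussianReal (μ * normalizedEnergy Q i (X ω) + o)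
          (τ * normalizedEnergy Q i (X ω)) ∂P := by
  have hQn : (n * Q : ℝ) ≠ 0 := by
    have : (0 : ℝ) < Q := hQ
    positivity
  set F : (Fin n → ℝ) × (Fin n → ℝ) → ℝ := fun q =>
    p * (activity Λ i * ∑ m, q.1 m ^ 2 + ∑ m, q.1 m * q.2 m) + o with hF
  have hFm : Measurable F := by fun_prop
  have ha := hM.aemeasurable_codeword i
  have hw := hM.aemeasurable_interference Λ i
  have hprod := (indepFun_iff_map_prod_eq_prod_map_map ha hw).1
    (hM.indepFun_codeword_interference Λ i)
  have := Measure.isProbabilityMeasure_map ha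
  have := Measure.isProbabilityMeasure_map hw
  have hInt : Integrable (fun q => g (F q)) ((P.map fun ω m => X ω m i).prod
      (P.map fun ω => interference Λ i (X ω) (z ω))) :=
    Integrable.of_bound (hg.comp_measurable hFm).aestronglyMeasurable B (ae_of_all _ fun q => hB _)
  have hinner : ∀ c : Fin n → ℝ, ∫ w, g (F (c, w)) ∂(P.map fun ω => interference Λ i (X ω) (z ω))
      = ∫ y, g y ∂gaussianReal (μ * ((∑ m, ‖c m‖₊ ^ 2) / (n * Q) : ℝ≥0) + o)
          (τ * ((∑ m, ‖c m‖₊ ^ 2) / (n * Q))) := by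
    intro c
    have hl := gaussianReal_add_const (gaussianReal_const_mul (gaussianReal_const_add
      (hM.hasLaw_sum_mul_interference Λ i c) (activity Λ i * ∑ m, c m ^ 2)) p) o
    rw [integral_map (f := fun w => g (F (c, w))) hw
      (hg.comp_measurable (hFm.comp measurable_prodMk_left)).aestronglyMeasurable]
    -- With the codeword frozen at `c`, `F (c, ·)` is affine in the interference; `hμ` and `hτ`
    -- match its parameters. The case `c = 0` is included as a point mass.
    have e : gaussianReal (μ * ((∑ m, ‖c m‖₊ ^ 2) / (n * Q) : ℝ≥0) + o)
          (τ * ((∑ m, ‖c m‖₊ ^ 2) / (n * Q)))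
        = gaussianReal (p * (0 + activity Λ i * ∑ m, c m ^ 2) + o)
          (.mk (p ^ 2) (sq_nonneg _) * (((Λ.erase i).card * Q + 1) * ∑ m, ‖c m‖₊ ^ 2)) := by
      congr 1
      · rw [← hμ]
        push_cast
        simp only [Real.norm_eq_abs, sq_abs]
        field_simp
        ring
      · ext
        push_cast
        rw [← hτ]
        simp only [Real.norm_eq_abs, sq_abs]
        field_simp
    rw [e, ← hl.map_eq, integral_map hl.aemeasurable hg.aestronglyMeasurable]
  calc ∫ ω, g (p * ostCorrelation Λ (X ω) (z ω) i + o) ∂P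
      = ∫ ω, g (F (fun m => X ω m i, interference Λ i (X ω) (z ω))) ∂P := by
        simp only [ostCorrelation_eq, hF]
    _ = ∫ q, g (F q) ∂((P.map fun ω m => X ω m i).prod
          (P.map fun ω => interference Λ i (X ω) (z ω))) := by
        rw [← hprod]
        exact (integral_map (f := fun q => g (F q)) (ha.prodMk hw)
          (hg.comp_measurable hFm).aestronglyMeasurable).symm
    _ = _ := by
        rw [integral_prod _ hInt, integral_map ha]
        · simp only [hinner, normalizedEnergy]
        · exact hInt.integral_prod_left.aestronglyMeasurable

/-! ### The normalized energy of a codeword -/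

/-- The normalized entries of a codeword are i.i.d. standard Gaussian. -/
lemma hasLaw_codeword_div_sqrt (hM : IsGaussianModel P Q X z) (hQ : 0 < Q) (i : Fin C)
    (m : Fin n) : HasLaw (fun ω => X ω m i / √(Q : ℝ)) (gaussianReal 0 1) P := by
  have h := gaussianReal_div_const (hM.codebook_law m i) (√(Q : ℝ))
  convert! h using 2
  · simp
  · ext
    have : (Q : ℝ) ≠ 0 := by exact_mod_cast hQ.ne'
    simp [this]

lemma iIndepFun_codeword (hM : IsGaussianModel P Q X z) (i : Fin C) :
    iIndepFun (fun (m : Fin n) ω => X ω m i) P := by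
  have := hM.indep.precomp (g := fun m : Fin n => (Sum.inl (m, i) : (Fin n × Fin C) ⊕ Fin n))
    (fun a b h => by simpa using h)
  simpa [Function.comp_def] using this

lemma normalizedEnergy_sub_one (hQ : 0 < Q) (hn : 0 < n) (i : Fin C)
    (X : Matrix (Fin n) (Fin C) ℝ) :
    (normalizedEnergy Q i X : ℝ) - 1 = (∑ m, ((X m i / √(Q : ℝ)) ^ 2 - 1)) / n := by
  have : (0 : ℝ) < Q := hQ
  rw [coe_normalizedEnergy, Finset.sum_sub_distrib]
  simp only [div_pow, Real.sq_sqrt this.le, ← Finset.sum_div]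
  simp
  field_simp

/-- Mean absolute deviation of the normalized energy. -/
lemma integrable_and_integral_abs_normalizedEnergy_sub_one_le [IsProbabilityMeasure P]
    (hM : IsGaussianModel P Q X z)
    (hQ : 0 < Q) (hn : 0 < n) (i : Fin C) :
    Integrable (fun ω => |(normalizedEnergy Q i (X ω) : ℝ) - 1|) P ∧
      ∫ ω, |(normalizedEnergy Q i (X ω) : ℝ) - 1| ∂P ≤ √2 / √n := by
  set f : Fin n → Ω → ℝ := fun m ω => (X ω m i / √(Q : ℝ)) ^ 2 - 1 with hf
  have hl := fun m => hM.hasLaw_codeword_div_sqrt hQ i m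
  have hmem : MemLp (fun x : ℝ => x ^ 2 - 1) 2 (gaussianReal 0 1) :=
    (memLp_two_iff_integrable_sq (by fun_prop)).2 integrable_sq_sub_one_sq_gaussianReal
  have hfm : ∀ m, MemLp (f m) 2 P := fun m => by
    have := hmem
    rw [← (hl m).map_eq] at this
    exact this.comp_of_map (hl m).aemeasurable
  have hmean : ∀ m, ∫ ω, f m ω ∂P = 0 := fun m =>
    ((hl m).integral_comp (f := fun x : ℝ => x ^ 2 - 1) (by fun_prop)).trans
      integral_sq_sub_one_gaussianReal
  have hvar : ∀ m, Var[f m; P] = 2 := fun m => by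
    rw [variance_eq_integral (hfm m).aemeasurable, hmean]
    simp only [sub_zero]
    exact ((hl m).integral_comp (f := fun x : ℝ => (x ^ 2 - 1) ^ 2) (by fun_prop)).trans
      integral_sq_sub_one_sq_gaussianReal
  have hind : iIndepFun f P :=
    (hM.iIndepFun_codeword i).comp (fun _ x => (x / √(Q : ℝ)) ^ 2 - 1) (fun _ => by fun_prop)
  have hsum : MemLp (∑ m, f m) 2 P := memLp_finsetSum' _ fun m _ => hfm m
  have hVsum : Var[∑ m, f m; P] = 2 * n := by
    rw [IndepFun.variance_sum (fun m _ => hfm m) (fun a _ b _ hab => hind.indepFun hab)]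
    simp [hvar, mul_comm]
  have hEsum : P[∑ m, f m] = 0 := by
    simp only [Finset.sum_apply]
    rw [integral_finsetSum _ fun m _ => (hfm m).integrable one_le_two]
    simp [hmean]
  have hsq : ∫ ω, (∑ m, f m ω) ^ 2 ∂P = 2 * n := by
    rw [variance_eq_integral hsum.aemeasurable, hEsum] at hVsum
    simpa using hVsum
  have heq : ∀ ω, (normalizedEnergy Q i (X ω) : ℝ) - 1 = (∑ m, f m) ω / n := fun ω => by
    rw [normalizedEnergy_sub_one hQ hn]; simp [hf]
  simp only [heq]
  have hn' : (0 : ℝ) < n := by exact_mod_cast hn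
  have hInt : Integrable (fun ω => |(∑ m, f m) ω|) P := (hsum.integrable one_le_two).abs
  -- Cauchy–Schwarz, in the form that the variance of the absolute value is nonnegative.
  have hcs : ∫ ω, |(∑ m, f m) ω| ∂P ≤ √(2 * n) := by
    apply Real.le_sqrt_of_sq_le
    have h0 := variance_nonneg |∑ m, f m| P
    rw [variance_eq_sub hsum.abs] at h0
    simp only [Pi.pow_apply, Pi.abs_apply, sq_abs, Finset.sum_apply, hsq] at h0
    simpa using h0
  simp only [abs_div, abs_of_pos hn']
  refine ⟨hInt.div_const _, ?_⟩
  rw [integral_div, div_le_iff₀ hn']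
  refine hcs.trans_eq ?_
  rw [Real.sqrt_mul (by norm_num)]
  field_simp
  rw [Real.sq_sqrt hn'.le]

end IsGaussianModel

/-! ### Distribution functions and characteristic functions of the correlations -/

lemma integrable_cdf_gaussianReal_comp {Ω : Type*} [MeasurableSpace Ω] {P : Measure Ω}
    [IsFiniteMeasure P] {m : Ω → ℝ} {v : Ω → ℝ≥0}
    (hm : AEMeasurable m P) (hv : AEMeasurable v P) (x : ℝ) :
    Integrable (fun ω => cdf (gaussianReal (m ω) (v ω)) x) P := by
  refine Integrable.of_bound (C := 1) ?_ (ae_of_all _ fun ω => ?_)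
  · simp only [cdf_eq_real, Measure.real]
    refine AEMeasurable.aestronglyMeasurable (AEMeasurable.ennreal_toReal ?_)
    exact ((Measure.measurable_coe measurableSet_Iic).comp
      measurable_gaussianReal).comp_aemeasurable (hm.prodMk hv)
  · rw [Real.norm_of_nonneg (cdf_nonneg _ _)]
    exact cdf_le_one _ _

namespace IsGaussianModel

variable {Ω : Type*} [MeasurableSpace Ω] {P : Measure Ω} {Q : ℝ≥0}
  {n C : ℕ} {X : Ω → Matrix (Fin n) (Fin C) ℝ} {z : Ω → Fin n → ℝ}

lemma cdf_map_ostCorrelation [IsProbabilityMeasure P] (hM : IsGaussianModel P Q X z) (hQ : 0 < Q)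
    (hn : 0 < n) (Λ : Finset (Fin C)) (i : Fin C) {p o μ : ℝ} {τ : ℝ≥0}
    (hμ : p * (activity Λ i * (n * Q)) = μ)
    (hτ : p ^ 2 * (((Λ.erase i).card * Q + 1) * (n * Q)) = (τ : ℝ)) (x : ℝ) :
    cdf (P.map fun ω => p * ostCorrelation Λ (X ω) (z ω) i + o) x
      = ∫ ω, cdf (gaussianReal (μ * normalizedEnergy Q i (X ω) + o)
          (τ * normalizedEnergy Q i (X ω))) x ∂P := by
  rw [cdf_map_eq_integral (((hM.aemeasurable_ostCorrelation Λ i).const_mul p).add_const o),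
    hM.integral_comp_ostCorrelation hQ hn Λ i
      (measurable_const.indicator measurableSet_Iic).stronglyMeasurable (B := 1) ?_ hμ hτ]
  · simp only [cdf_eq_integral]
  · intro y
    simp only [Set.indicator]
    split_ifs <;> simp

lemma charFun_map_ostCorrelation [IsProbabilityMeasure P] (hM : IsGaussianModel P Q X z)
    (hQ : 0 < Q) (hn : 0 < n) (Λ : Finset (Fin C)) (i : Fin C) {p μ : ℝ} {τ : ℝ≥0}
    (hμ : p * (activity Λ i * (n * Q)) = μ)
    (hτ : p ^ 2 * (((Λ.erase i).card * Q + 1) * (n * Q)) = (τ : ℝ)) (t : ℝ) :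
    charFun (P.map fun ω => p * ostCorrelation Λ (X ω) (z ω) i) t
      = ∫ ω, Complex.exp ((t * μ * Complex.I - τ * t ^ 2 / 2)
          * (normalizedEnergy Q i (X ω) : ℝ)) ∂P := by
  have hm : AEMeasurable (fun ω => p * ostCorrelation Λ (X ω) (z ω) i) P :=
    (hM.aemeasurable_ostCorrelation Λ i).const_mul p
  have h := hM.integral_comp_ostCorrelation hQ hn Λ i (o := 0)
    (g := fun y : ℝ => Complex.exp (t * y * Complex.I))
    (by fun_prop : Continuous fun y : ℝ => Complex.exp (t * y * Complex.I)).stronglyMeasurable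
    (B := 1) (fun y => by
      rw [← Complex.ofReal_mul, Complex.norm_exp_ofReal_mul_I]) hμ hτ
  rw [charFun_apply_real, integral_map hm (by fun_prop)]
  simp only [add_zero] at h
  rw [h]
  refine integral_congr_ae (ae_of_all _ fun ω => ?_)
  simp only
  rw [← charFun_apply_real, charFun_gaussianReal]
  congr 1
  push_cast
  ring

/-- Replacing the conditional variance of a correlation by its expectation. -/
lemma abs_integral_cdf_gaussianReal_sub_le [IsProbabilityMeasure P]
    (hM : IsGaussianModel P Q X z) (hQ : 0 < Q) (hn : 0 < n) (i : Fin C) (μ o : ℝ) {τ : ℝ≥0}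
    (hτ : τ ≠ 0) (x : ℝ) :
    |∫ ω, cdf (gaussianReal (μ * normalizedEnergy Q i (X ω) + o)
          (τ * normalizedEnergy Q i (X ω))) x ∂P
        - ∫ ω, cdf (gaussianReal (μ * normalizedEnergy Q i (X ω) + o) τ) x ∂P|
      ≤ 3 / 2 * (√2 / √n) := by
  have hV := hM.aemeasurable_normalizedEnergy i
  have hm : AEMeasurable (fun ω => μ * (normalizedEnergy Q i (X ω) : ℝ) + o) P :=
    (hV.coe_nnreal_real.const_mul μ).add_const o
  obtain ⟨hInt, hle⟩ := hM.integrable_and_integral_abs_normalizedEnergy_sub_one_le hQ hn i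
  rw [← integral_sub (integrable_cdf_gaussianReal_comp hm (hV.const_mul τ) x)
    (integrable_cdf_gaussianReal_comp hm aemeasurable_const x)]
  refine (norm_integral_le_of_norm_le (hInt.const_mul (3 / 2)) (ae_of_all _ fun ω =>
    (Real.norm_eq_abs _).trans_le (abs_cdf_gaussianReal_mul_var_sub_le _ hτ _ x))).trans ?_
  rw [integral_const_mul]
  gcongr

/-- Gaussian approximation of the smoothed normalized energy. -/
lemma abs_integral_cdf_gaussianReal_energy_sub_le [IsProbabilityMeasure P]
    (hM : IsGaussianModel P Q X z) (hQ : 0 < Q) (hn : 0 < n) (i : Fin C) {μ : ℝ} {τ : ℝ≥0}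
    (hμ : 0 ≤ μ) (hτ : τ ≠ 0) (hμτ : μ ^ 2 / n ≤ τ) (hsum : (τ : ℝ) + 2 * (μ ^ 2 / n) = 1)
    (x : ℝ) :
    |∫ ω, cdf (gaussianReal (μ * normalizedEnergy Q i (X ω) + -μ) τ) x ∂P
      - cdf (gaussianReal 0 1) x| ≤ 11 / √n := by
  have hn' : (0 : ℝ) < n := by exact_mod_cast hn
  set a : ℝ := μ / n with ha
  have ha0 : 0 ≤ a := by positivity
  set f : ℝ → ℝ := fun y => a * (y ^ 2 - 1) with hf
  have hfm : Measurable f := by fun_prop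
  set ν := (gaussianReal 0 1).map f with hν
  have : IsProbabilityMeasure ν := Measure.isProbabilityMeasure_map hfm.aemeasurable
  set ξ : Fin n → Ω → ℝ := fun m ω => f (X ω m i / √(Q : ℝ)) with hξ
  have hlaw : ∀ m, HasLaw (ξ m) ν P := fun m =>
    HasLaw.fun_comp ⟨hfm.aemeasurable, rfl⟩ (hM.hasLaw_codeword_div_sqrt hQ i m)
  have hind : iIndepFun ξ P :=
    (hM.iIndepFun_codeword i).comp (fun _ x => f (x / √(Q : ℝ))) (fun _ => by fun_prop)
  -- The variance of one summand `a (ξ² - 1)`, since `ξ²` has variance 2.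
  let σ : ℝ≥0 := ⟨2 * a ^ 2, by positivity⟩
  have h1 : Integrable (fun w => w) ν :=
    (integrable_map_measure (by fun_prop) hfm.aemeasurable).2
      (integrable_sq_sub_one_gaussianReal.const_mul a)
  have h2 : Integrable (fun w => w ^ 2) ν := by
    refine (integrable_map_measure (by fun_prop) hfm.aemeasurable).2 ?_
    simpa [Function.comp_def, hf, mul_pow] using
      integrable_sq_sub_one_sq_gaussianReal.const_mul (a ^ 2)
  have h3 : Integrable (fun w => |w| ^ 3) ν := by
    refine (integrable_map_measure (by fun_prop) hfm.aemeasurable).2 ?_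
    simpa [Function.comp_def, hf, mul_pow, abs_mul] using
      integrable_abs_sq_sub_one_pow_three_gaussianReal.const_mul (|a| ^ 3)
  have e1 : ∫ w, w ∂ν = 0 := by
    rw [hν, integral_map hfm.aemeasurable (by fun_prop)]
    simp only [hf, integral_const_mul, integral_sq_sub_one_gaussianReal, mul_zero]
  have e2 : ∫ w, w ^ 2 ∂ν = σ := by
    rw [hν, integral_map hfm.aemeasurable (by fun_prop)]
    simp only [hf, mul_pow, integral_const_mul, integral_sq_sub_one_sq_gaussianReal]
    exact mul_comm _ _
  have e3 : ∫ w, |w| ^ 3 ∂ν ≤ 16 * a ^ 3 := by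
    rw [hν, integral_map hfm.aemeasurable (by fun_prop)]
    simp only [hf, mul_pow, abs_mul, integral_const_mul, abs_of_nonneg ha0]
    nlinarith [integral_abs_sq_sub_one_pow_three_gaussianReal_le, pow_nonneg ha0 3]
  have main := abs_integral_cdf_sub_sum_le hind hlaw hτ h1 h2 h3 e1 e2 e3 Finset.univ x
  have hmean : ∀ ω, μ * (normalizedEnergy Q i (X ω) : ℝ) + -μ = ∑ m, ξ m ω := by
    intro ω
    have := normalizedEnergy_sub_one hQ hn i (X ω)
    simp only [hξ, hf, ← Finset.mul_sum, ha]
    rw [div_mul_eq_mul_div, mul_div_assoc, ← this]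
    ring
  have hcdf : ∀ ω, cdf (gaussianReal (μ * normalizedEnergy Q i (X ω) + -μ) τ) x
      = cdf (gaussianReal 0 τ) (x - ∑ m, ξ m ω) := by
    intro ω
    rw [hmean, ← cdf_gaussianReal_sub, zero_add]
  have hσ : τ + (Finset.univ : Finset (Fin n)).card * σ = 1 := by
    ext
    push_cast
    rw [Finset.card_univ, Fintype.card_fin, ← hsum]
    change (τ : ℝ) + n * (2 * a ^ 2) = _
    rw [ha]
    field_simp
  rw [hσ] at main
  simp only [hcdf]
  refine main.trans ?_
  rw [Finset.card_univ, Fintype.card_fin]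
  have hs : 0 < √(τ : ℝ) := Real.sqrt_pos.2 (by exact_mod_cast pos_iff_ne_zero.2 hτ)
  have hsn : 0 < √(n : ℝ) := Real.sqrt_pos.2 hn'
  set s := √(τ : ℝ)
  set r := √(n : ℝ)
  have hr2 : r ^ 2 = n := Real.sq_sqrt hn'.le
  have hs2 : s ^ 2 = τ := Real.sq_sqrt τ.coe_nonneg
  -- This is `hμτ`, as `n a² = μ²/n`. It makes the total error scale free: `n` exchanges of size
  -- `a³/s³` give `(a r / s)³ / r` up to a constant.
  have har : a * r ≤ s := by
    refine le_of_sq_le_sq ?_ hs.le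
    rw [hs2, mul_pow, hr2]
    refine le_trans (le_of_eq ?_) hμτ
    rw [ha]; field_simp
  have hσs : √(σ : ℝ) = √2 * a := by
    change √(2 * a ^ 2) = _
    rw [Real.sqrt_mul (by norm_num), Real.sqrt_sq ha0]
  have h22 : √2 ≤ 1.42 := by
    rw [Real.sqrt_le_left (by norm_num)]; norm_num
  have h23 : √2 ^ 3 ≤ 3 := by
    have : √2 ^ 2 = 2 := Real.sq_sqrt (by norm_num)
    nlinarith
  rw [hσs, mul_pow, le_div_iff₀ hsn, ← hr2]
  have hcube : (a * r) ^ 3 ≤ s ^ 3 := by gcongr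
  calc r ^ 2 * (1 / (2 * s ^ 3) * (16 * a ^ 3 + 2 * (√2 ^ 3 * a ^ 3))) * r
      = (16 + 2 * √2 ^ 3) / 2 * ((a * r) ^ 3 / s ^ 3) := by field_simp
    _ ≤ (16 + 2 * 3) / 2 * 1 := by
        gcongr
        exact div_le_one_of_le₀ hcube (by positivity)
    _ = 11 := by norm_num

/-! ### Explicit error bounds for a single problem. -/

lemma abs_cdf_ostCorrelation_sub_le_of_notMem [IsProbabilityMeasure P]
    (hM : IsGaussianModel P Q X z) (hQ : 0 < Q) (hn : 0 < n) {Λ : Finset (Fin C)} {i : Fin C}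
    (hi : i ∉ Λ) (x : ℝ) :
    |cdf (P.map fun ω => ostCorrelation Λ (X ω) (z ω) i /
        ((n : ℝ) * (Q : ℝ) * √(((Λ.card : ℝ) + 1 / (Q : ℝ)) / (n : ℝ)))) x
      - cdf (gaussianReal 0 1) x| ≤ 8 / (Real.pi * √(n : ℝ)) := by
  have hn' : (0 : ℝ) < n := by exact_mod_cast hn
  have hQ' : (0 : ℝ) < Q := hQ
  set d := (n : ℝ) * (Q : ℝ) * √(((Λ.card : ℝ) + 1 / (Q : ℝ)) / (n : ℝ)) with hd
  have hd2 : d ^ 2 = (Λ.card * Q + 1) * (n * Q) := by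
    rw [hd, mul_pow, Real.sq_sqrt (by positivity)]
    field_simp
  have hd0 : d ≠ 0 := by
    rintro h
    rw [h] at hd2
    have : 0 < (Λ.card * Q + 1) * (n * Q : ℝ) := by positivity
    linarith
  -- The mixture is over `N(0, V)`, so only the variance replacement is needed; `(3/2) √2 < 8/π`.
  have h := hM.cdf_map_ostCorrelation hQ hn Λ i (p := d⁻¹) (o := 0) (μ := 0) (τ := 1)
    (by simp [activity, hi])
    (by rw [Finset.erase_eq_of_notMem hi, ← hd2]; simp [hd0]) x
  have h' := hM.abs_integral_cdf_gaussianReal_sub_le hQ hn i 0 0 one_ne_zero x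
  rw [← h] at h'
  simp only [add_zero, zero_mul, integral_const, probReal_univ, one_smul] at h'
  simp only [div_eq_inv_mul _ d]
  refine h'.trans ?_
  have hsn : 0 < √(n : ℝ) := Real.sqrt_pos.2 hn'
  have h22 : √2 ≤ 1.42 := by
    rw [Real.sqrt_le_left (by norm_num)]; norm_num
  rw [← div_div, ← mul_div_assoc]
  refine div_le_div_of_nonneg_right ?_ hsn.le
  rw [le_div_iff₀ Real.pi_pos]
  nlinarith [Real.pi_lt_d2, Real.pi_pos]

/-- The normalization has `K + 1` because the `K - 1` other codewords are joined by the fluctuation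
of `‖x‖²`, of variance `2nQ²`, which counts as two more. -/
lemma abs_cdf_ostCorrelation_sub_le_of_mem [IsProbabilityMeasure P]
    (hM : IsGaussianModel P Q X z) (hQ : 0 < Q) (hn : 0 < n) {Λ : Finset (Fin C)} {i : Fin C}
    (hi : i ∈ Λ) (hK : 2 ≤ Λ.card) (x : ℝ) :
    |cdf (P.map fun ω => (ostCorrelation Λ (X ω) (z ω) i - (n : ℝ) * (Q : ℝ)) /
        ((n : ℝ) * (Q : ℝ) * √(((Λ.card : ℝ) + 1 + 1 / (Q : ℝ)) / (n : ℝ)))) x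
      - cdf (gaussianReal 0 1) x| ≤ 64 / (Real.pi * √(n : ℝ)) := by
  have hn' : (0 : ℝ) < n := by exact_mod_cast hn
  have hQ' : (0 : ℝ) < Q := hQ
  have hK' : (2 : ℝ) ≤ Λ.card := by exact_mod_cast hK
  have hk : ((Λ.erase i).card : ℝ) = Λ.card - 1 := by
    rw [Finset.card_erase_of_mem hi, Nat.cast_sub (by omega)]; simp
  set d := (n : ℝ) * (Q : ℝ) * √(((Λ.card : ℝ) + 1 + 1 / (Q : ℝ)) / (n : ℝ)) with hd
  have hd2 : d ^ 2 = ((Λ.card + 1) * Q + 1) * (n * Q) := by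
    rw [hd, mul_pow, Real.sq_sqrt (by positivity)]
    field_simp
  have hd0 : 0 < d := by
    rw [hd]
    have : 0 < √(((Λ.card : ℝ) + 1 + 1 / (Q : ℝ)) / (n : ℝ)) := Real.sqrt_pos.2 (by positivity)
    positivity
  have hD : 0 < ((Λ.card : ℝ) + 1) * Q + 1 := by positivity
  set μ := n * Q / d with hμ
  have hμ2 : μ ^ 2 / n = Q / ((Λ.card + 1) * Q + 1) := by
    rw [hμ, div_pow, hd2]
    field_simp
  have hτ0 : 0 < ((Λ.card : ℝ) - 1) * Q + 1 := by nlinarith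
  let τ : ℝ≥0 := ⟨(((Λ.card : ℝ) - 1) * Q + 1) / ((Λ.card + 1) * Q + 1), by positivity⟩
  have hτ : (τ : ℝ) = (((Λ.card : ℝ) - 1) * Q + 1) / ((Λ.card + 1) * Q + 1) := rfl
  have hτne : τ ≠ 0 := by
    have : (0 : ℝ) < τ := by rw [hτ]; positivity
    exact_mod_cast this.ne'
  have h := hM.cdf_map_ostCorrelation hQ hn Λ i (p := d⁻¹) (o := -μ) (μ := μ) (τ := τ)
    (by simp [activity, hi, hμ, div_eq_inv_mul])
    (by rw [hk, hτ, inv_pow, hd2]; field_simp) x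
  have h1 := hM.abs_integral_cdf_gaussianReal_sub_le hQ hn i μ (-μ) hτne x
  have h2 := hM.abs_integral_cdf_gaussianReal_energy_sub_le hQ hn i (μ := μ) (τ := τ)
    (by positivity) hτne
    -- Here `K ≥ 2` enters: the claim reduces to `Q ≤ (K - 1) Q + 1`, with no constant depending on
    -- `Q`.
    (by rw [hμ2, hτ]; gcongr; nlinarith)
    (by rw [hμ2, hτ]; field_simp; ring) x
  rw [← h] at h1
  have e : (fun ω => (ostCorrelation Λ (X ω) (z ω) i - (n : ℝ) * (Q : ℝ)) / d)
      = fun ω => d⁻¹ * ostCorrelation Λ (X ω) (z ω) i + -μ := by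
    ext ω; rw [hμ]; ring
  rw [e]
  have hsn : 0 < √(n : ℝ) := Real.sqrt_pos.2 hn'
  have h22 : √2 ≤ 1.42 := by
    rw [Real.sqrt_le_left (by norm_num)]; norm_num
  have h3 : 3 / 2 * (√2 / √(n : ℝ)) + 11 / √(n : ℝ) ≤ 64 / (Real.pi * √(n : ℝ)) := by
    rw [← div_div, ← mul_div_assoc, ← add_div]
    refine div_le_div_of_nonneg_right ?_ hsn.le
    rw [le_div_iff₀ Real.pi_pos]
    nlinarith [Real.pi_lt_d2, Real.pi_pos]
  exact (abs_sub_le _ _ _).trans ((add_le_add h1 h2).trans h3)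

end IsGaussianModel

/-! ### Convergence in distribution -/

/-- On `s ≥ 0` the derivative `w exp(ws)` has norm at most `‖w‖`. -/
lemma norm_exp_mul_sub_exp_le {w : ℂ} (hw : w.re ≤ 0) {V : ℝ} (hV : 0 ≤ V) :
    ‖Complex.exp (w * V) - Complex.exp w‖ ≤ ‖w‖ * |V - 1| := by
  have hd : ∀ s : ℝ, HasDerivAt (fun s : ℝ => Complex.exp (w * s)) (Complex.exp (w * s) * w) s := by
    intro s
    have := ((Complex.ofRealCLM.hasDerivAt (x := s)).const_mul w).cexp
    simpa using this
  have := (convex_Ici (0 : ℝ)).norm_image_sub_le_of_norm_hasDerivWithin_le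
    (f := fun s : ℝ => Complex.exp (w * s)) (C := ‖w‖) (x := 1) (y := V)
    (fun s _ => (hd s).hasDerivWithinAt) (fun s hs => by
      rw [norm_mul, Complex.norm_exp]
      refine mul_le_of_le_one_left (norm_nonneg _) (Real.exp_le_one_iff.2 ?_)
      simpa using mul_nonpos_of_nonpos_of_nonneg hw hs) (by simp) (by simpa using hV)
  simpa using this

/-- Convergence in distribution of the correlations of a sequence of codewords, all transmitted
(`ε = 1`) or all idle (`ε = 0`). -/
lemma tendstoInDistribution_ostCorrelation {Q : ℝ≥0} (hQ : 0 < Q) {Ω : ℕ → Type*}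
    [∀ r, MeasurableSpace (Ω r)] (P : ∀ r, Measure (Ω r)) [∀ r, IsProbabilityMeasure (P r)]
    {n C : ℕ → ℕ} {ε : ℝ} {ρ : ℝ≥0} {Λ : ∀ r, Finset (Fin (C r))}
    {X : ∀ r, Ω r → Matrix (Fin (n r)) (Fin (C r)) ℝ} {z : ∀ r, Ω r → Fin (n r) → ℝ}
    (hM : ∀ r, IsGaussianModel (P r) Q (X r) (z r)) (hn : Tendsto n atTop atTop)
    (i : ∀ r, Fin (C r)) (hε : ∀ r, activity (Λ r) (i r) = ε)
    (hρ : Tendsto (fun r => ((((Λ r).erase (i r)).card : ℝ) + 1 / (Q : ℝ)) / (n r : ℝ)) atTop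
      (𝓝 (ρ : ℝ))) :
    TendstoInDistribution
      (fun r ω => ostCorrelation (Λ r) (X r ω) (z r ω) (i r) / ((n r : ℝ) * (Q : ℝ)))
      atTop id P (gaussianReal ε ρ) := by
  have hQ' : (0 : ℝ) < Q := hQ
  refine ⟨fun r => ((hM r).aemeasurable_ostCorrelation (Λ r) (i r)).div_const _, by fun_prop, ?_⟩
  refine ProbabilityMeasure.tendsto_of_tendsto_charFun fun t => ?_
  simp only [ProbabilityMeasure.coe_mk, Measure.map_id, charFun_gaussianReal]
  let τ : ℕ → ℝ≥0 := fun r =>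
    ⟨((((Λ r).erase (i r)).card : ℝ) + 1 / (Q : ℝ)) / (n r : ℝ), by positivity⟩
  let w : ℕ → ℂ := fun r => t * ε * Complex.I - (τ r : ℝ) * t ^ 2 / 2
  have hw : Tendsto w atTop (𝓝 (t * ε * Complex.I - (ρ : ℝ) * t ^ 2 / 2)) := by
    have : Tendsto (fun r => ((τ r : ℝ) : ℂ)) atTop (𝓝 ((ρ : ℝ) : ℂ)) :=
      (Complex.continuous_ofReal.tendsto _).comp hρ
    exact tendsto_const_nhds.sub ((this.mul_const _).div_const _)
  have hre : ∀ r, (w r).re ≤ 0 := by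
    intro r
    have : (w r).re = -((τ r : ℝ) * t ^ 2 / 2) := by
      have : w r = ((-((τ r : ℝ) * t ^ 2 / 2) : ℝ) : ℂ) + ((t * ε : ℝ) : ℂ) * Complex.I := by
        simp only [w]; push_cast; ring
      rw [this, Complex.add_re, Complex.ofReal_re, Complex.re_ofReal_mul, Complex.I_re, mul_zero,
        add_zero]
    rw [this]
    have : 0 ≤ (τ r : ℝ) * t ^ 2 / 2 := by positivity
    linarith
  have hexp : Tendsto (fun r => Complex.exp (w r)) atTop
      (𝓝 (Complex.exp (t * ε * Complex.I - (ρ : ℝ) * t ^ 2 / 2))) :=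
    (Complex.continuous_exp.tendsto _).comp hw
  refine (tendsto_iff_of_dist (f₁ := fun r => Complex.exp (w r)) ?_).1 hexp
  have hbound : Tendsto (fun r => ‖w r‖ * (√2 / √(n r : ℝ))) atTop (𝓝 0) := by
    have h0 : Tendsto (fun r => √2 / √(n r : ℝ)) atTop (𝓝 0) :=
      tendsto_const_nhds.div_atTop (Real.tendsto_sqrt_atTop.comp
        (tendsto_natCast_atTop_atTop.comp hn))
    simpa using hw.norm.mul h0
  refine squeeze_zero' (Eventually.of_forall fun r => dist_nonneg) ?_ hbound
  -- The normalized energy is meaningful only for `n r > 0`.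
  filter_upwards [hn.eventually_gt_atTop 0] with r hr
  have hr' : (0 : ℝ) < n r := by exact_mod_cast hr
  have hch := (hM r).charFun_map_ostCorrelation hQ hr (Λ r) (i r) (p := ((n r : ℝ) * Q)⁻¹)
    (μ := ε) (τ := τ r) (by rw [hε]; field_simp)
    (by
      change _ = ((((Λ r).erase (i r)).card : ℝ) + 1 / (Q : ℝ)) / (n r : ℝ)
      field_simp) t
  simp only [div_eq_inv_mul _ ((n r : ℝ) * Q)]
  rw [hch, dist_comm, dist_eq_norm]
  obtain ⟨hInt, hle⟩ := (hM r).integrable_and_integral_abs_normalizedEnergy_sub_one_le hQ hr (i r)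
  have hV := ((hM r).aemeasurable_normalizedEnergy (i r)).coe_nnreal_real
  have hiexp : Integrable (fun ω => Complex.exp (w r * (normalizedEnergy Q (i r) (X r ω) : ℝ)))
      (P r) := by
    refine Integrable.of_bound (C := 1) ?_ (ae_of_all _ fun ω => ?_)
    · exact (Complex.measurable_exp.comp_aemeasurable
        ((Complex.measurable_ofReal.comp_aemeasurable hV).const_mul _)).aestronglyMeasurable
    · rw [Complex.norm_exp, Real.exp_le_one_iff, Complex.re_mul_ofReal]
      exact mul_nonpos_of_nonpos_of_nonneg (hre r) (NNReal.coe_nonneg _)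
  have hconst : Complex.exp (w r) = ∫ _, Complex.exp (w r) ∂(P r) := by simp
  rw [hconst]
  change ‖∫ ω, Complex.exp (w r * (normalizedEnergy Q (i r) (X r ω) : ℝ)) ∂(P r) - _‖ ≤ _
  rw [← integral_sub hiexp (integrable_const _)]
  calc _ ≤ ∫ ω, ‖w r‖ * |(normalizedEnergy Q (i r) (X r ω) : ℝ) - 1| ∂(P r) :=
        norm_integral_le_of_norm_le (hInt.const_mul _) (ae_of_all _ fun ω =>
          norm_exp_mul_sub_exp_le (hre r) (NNReal.coe_nonneg _))
    _ ≤ _ := by rw [integral_const_mul]; gcongr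

theorem theorem1 (Q : ℝ≥0) (hQ : 0 < Q) :
    -- convergence in distribution of the normalized correlations
    (∀ {Ω : ℕ → Type*} [∀ r, MeasurableSpace (Ω r)] (P : ∀ r, Measure (Ω r))
        [∀ r, IsProbabilityMeasure (P r)] (K n C : ℕ → ℕ) (δ : ℝ) (ρ : ℝ≥0)
        (Λ : ∀ r, Finset (Fin (C r)))
        (X : ∀ r, Ω r → Matrix (Fin (n r)) (Fin (C r)) ℝ) (z : ∀ r, Ω r → Fin (n r) → ℝ),
      (∀ r, (Λ r).card = K r) →
      (∀ r, IsGaussianModel (P r) Q (X r) (z r)) →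
      Tendsto n atTop atTop →
      Tendsto (fun r => (K r : ℝ) / (C r : ℝ)) atTop (𝓝 δ) →
      Tendsto (fun r => ((K r : ℝ) + 1 / (Q : ℝ)) / (n r : ℝ)) atTop (𝓝 (ρ : ℝ)) →
      ∀ i : ∀ r, Fin (C r),
        ((∀ r, i r ∈ Λ r) →
          TendstoInDistribution
            (fun r ω => ostCorrelation (Λ r) (X r ω) (z r ω) (i r) / ((n r : ℝ) * (Q : ℝ)))
            atTop id P (gaussianReal 1 ρ)) ∧
        ((∀ r, i r ∉ Λ r) →
          TendstoInDistribution
            (fun r ω => ostCorrelation (Λ r) (X r ω) (z r ω) (i r) / ((n r : ℝ) * (Q : ℝ)))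
            atTop id P (gaussianReal 0 ρ))) ∧
    -- explicit bounds for a single problem
    (∀ {Ω : Type*} [MeasurableSpace Ω] (P : Measure Ω) [IsProbabilityMeasure P] (K n C : ℕ)
        (Λ : Finset (Fin C)) (X : Ω → Matrix (Fin n) (Fin C) ℝ) (z : Ω → Fin n → ℝ),
      Λ.card = K →
      IsGaussianModel P Q X z →
      ∀ i : Fin C,
        (i ∉ Λ → 1 ≤ n → ∀ x : ℝ,
          |cdf (P.map fun ω => ostCorrelation Λ (X ω) (z ω) i /
              ((n : ℝ) * (Q : ℝ) * √(((K : ℝ) + 1 / (Q : ℝ)) / (n : ℝ)))) x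
            - cdf (gaussianReal 0 1) x| ≤ 8 / (Real.pi * √(n : ℝ))) ∧
        (i ∈ Λ → 2 ≤ K → 12 ≤ n → ∀ x : ℝ,
          |cdf (P.map fun ω => (ostCorrelation Λ (X ω) (z ω) i - (n : ℝ) * (Q : ℝ)) /
              ((n : ℝ) * (Q : ℝ) * √(((K : ℝ) + 1 + 1 / (Q : ℝ)) / (n : ℝ)))) x
            - cdf (gaussianReal 0 1) x| ≤ 64 / (Real.pi * √(n : ℝ)))) := by
  refine ⟨?_, ?_⟩
  · intro Ω _ P _ K n C δ ρ Λ X z hK hM hn _ hρ i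
    refine ⟨fun hi => ?_, fun hi => ?_⟩
    · refine tendstoInDistribution_ostCorrelation hQ P hM hn i (fun r => by simp [activity, hi r]) ?_
      -- A transmitted message has `K - 1` interferers, which changes the variance ratio by `1/n`.
      have h0 : Tendsto (fun r => 1 / (n r : ℝ)) atTop (𝓝 0) :=
        tendsto_const_nhds.div_atTop (tendsto_natCast_atTop_atTop.comp hn)
      have h1 := hρ.sub h0
      rw [sub_zero] at h1
      refine h1.congr fun r => ?_
      have hpos : 1 ≤ (Λ r).card := Finset.card_pos.2 ⟨i r, hi r⟩
      rw [Finset.card_erase_of_mem (hi r), Nat.cast_sub hpos, hK r]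
      push_cast
      ring
    · refine tendstoInDistribution_ostCorrelation hQ P hM hn i (fun r => by simp [activity, hi r]) ?_
      refine hρ.congr fun r => ?_
      rw [Finset.erase_eq_of_notMem (hi r), hK r]
  · intro Ω _ P _ K n C Λ X z hK hM i
    subst hK
    exact ⟨fun hi hn x => hM.abs_cdf_ostCorrelation_sub_le_of_notMem hQ hn hi x,
      fun hi hK hn x => hM.abs_cdf_ostCorrelation_sub_le_of_mem hQ (by omega) hi hK x⟩
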